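/- Let $X$ be a complex Banach space and let $S$ be a linear operator in $X$ with domain $\mathcal D(S)\subset X$. Its resolvent set $\varrho(S)$ consists of all $\lambda\in\mathbb C$ such that $S-\lambda:\mathcal D(S)\to X$ is bijective with bounded inverse, and $\sigma(S)=\mathbb C\setminus\varrho(S)$. The operator $S$ is called * *bisectorial* if $i\mathbb R\setminus\{0\}\subset\varrho(S)$ and there is $M$ with $\|(S-\lambda)^{-1}\|\le M/|\lambda|$ for all $\lambda\in i\mathbb R\setminus\{0\}$; * *almost bisectorial with exponent $\beta$*, where $0<\beta<1$, if $i\mathbb R\setminus\{0\}\subset\varrho(S)$ and there is $M$ with $\|(S-\lambda)^{-1}\|\le M/|\lambda|^{\beta}$ for all $\lambda\in i\mathbb R\setminus\{0\}$; * *strictly dichotomous* if $i\mathbb R\subset\varrho(S)$ and there are closed subspaces $X_+,X_-$ with $X=X_+\oplus X_-$ which are $S$-invariant (that is, $S$ maps $\mathcal D(S)\cap X_\pm$ into $X_\pm$) such that the restrictions $S|X_\pm$, regarded as operators in $X_\pm$ with domains $\mathcal D(S)\cap X_\pm$, satisfy $\sigma(S|X_+)\subset\{\operatorname{Re}\lambda>0\}$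 and $\sigma(S|X_-)\subset\{\operatorname{Re}\lambda<0\}$, with $\|(S|X_+-\lambda)^{-1}\|$ bounded on $\{\operatorname{Re}\lambda\le 0\}$ and $\|(S|X_--\lambda)^{-1}\|$ bounded on $\{\operatorname{Re}\lambda\ge 0\}$. **Theorem.** Let $S$ be a densely defined linear operator in $X$ that is strictly dichotomous and almost bisectorial with exponent $\beta\in(0,1)$. Let $T$ be a densely defined linear operator in $X$ and $\varepsilon>0$ such that 1. $i\mathbb R\subset\varrho(T)$; 2. $\sup_{\lambda\in i\mathbb R}|\lambda|^{1+\varepsilon}\,\|(S-\lambda)^{-1}-(T-\lambda)^{-1}\|<\infty$; 3. $\mathcal D(S)\cap\mathcal D(T)$ is dense in $X$. Then $T$ is strictly dichotomous and almost bisectorial with the same exponent $\beta$. Moreover, if $S$ is bisectorial, then so is $T$. -/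

import Mathlib

namespace LinearPMap

section

variable {X : Type*} [NormedAddCommGroup X] [NormedSpace ℂ X]

/-- The bounded operator `R` is a two-sided inverse of `S - z : D(S) → X`. -/
def IsResolventAt (S : X →ₗ.[ℂ] X) (z : ℂ) (R : X →L[ℂ] X) : Prop :=
  (∀ x : X, ∃ h : R x ∈ S.domain, S ⟨R x, h⟩ - z • R x = x) ∧
    ∀ x : S.domain, R (S x - z • (x : X)) = x

/-- The inverse of `S - z` is unique, so `opResolvent` below does not depend on a choice. -/
theorem IsResolventAt.unique {S : X →ₗ.[ℂ] X} {z : ℂ} {R R' : X →L[ℂ] X}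
    (hR : S.IsResolventAt z R) (hR' : S.IsResolventAt z R') : R = R' := by
  ext x
  obtain ⟨h, hx⟩ := hR'.1 x
  have := hR.2 ⟨R' x, h⟩
  rw [hx] at this
  exact this

/-- The resolvent set of the operator `S`: all `z` such that `S - z : D(S) → X` is bijective
with bounded inverse. -/
def opResolventSet (S : X →ₗ.[ℂ] X) : Set ℂ :=
  {z | ∃ R : X →L[ℂ] X, S.IsResolventAt z R}

/-- The spectrum of the operator `S`. -/
def opSpectrum (S : X →ₗ.[ℂ] X) : Set ℂ :=
  (opResolventSet S)ᶜ

open Classical in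
/-- The resolvent `(S - z)⁻¹` for `z` in the resolvent set (and `0` for other `z`). -/
noncomputable def opResolvent (S : X →ₗ.[ℂ] X) (z : ℂ) : X →L[ℂ] X :=
  if h : ∃ R : X →L[ℂ] X, S.IsResolventAt z R then h.choose else 0

/-- The subspace `U` is `S`-invariant: `S` maps `D(S) ∩ U` into `U`. -/
def IsInvariant (S : X →ₗ.[ℂ] X) (U : Submodule ℂ X) : Prop :=
  ∀ x : S.domain, (x : X) ∈ U → S x ∈ U

/-- The restriction `S|U` to an `S`-invariant subspace, an operator in `U` with domain
`D(S) ∩ U`. -/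
def restrictTo (S : X →ₗ.[ℂ] X) (U : Submodule ℂ X) (hU : S.IsInvariant U) : U →ₗ.[ℂ] U where
  domain := S.domain.comap U.subtype
  toFun :=
    { toFun := fun x => ⟨S ⟨((x : U) : X), x.2⟩, hU _ (x : U).2⟩
      map_add' := fun x y => Subtype.ext (S.map_add ⟨((x : U) : X), x.2⟩ ⟨((y : U) : X), y.2⟩)
      map_smul' := fun c x => Subtype.ext (S.map_smul c ⟨((x : U) : X), x.2⟩) }

/-- `S` is dichotomous with respect to the decomposition of `X` as the direct sum of the
closed subspaces `Xp` and `Xm`. -/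
structure IsDichotomousWrt (S : X →ₗ.[ℂ] X) (Xp Xm : Submodule ℂ X) : Prop where
  isClosed_pos : _root_.IsClosed (Xp : Set X)
  isClosed_neg : _root_.IsClosed (Xm : Set X)
  isCompl : IsCompl Xp Xm
  imAxis_subset : {z : ℂ | z.re = 0} ⊆ opResolventSet S
  inv_pos : S.IsInvariant Xp
  inv_neg : S.IsInvariant Xm
  spec_pos : opSpectrum (S.restrictTo Xp inv_pos) ⊆ {z : ℂ | 0 < z.re}
  spec_neg : opSpectrum (S.restrictTo Xm inv_neg) ⊆ {z : ℂ | z.re < 0}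

/-- `S` is strictly dichotomous with respect to the decomposition of `X` as the direct sum of
`Xp` and `Xm`: in addition, the resolvents of the restrictions of `S` to `Xp` and `Xm` are
bounded on the closed left and the closed right half-plane, respectively. -/
structure IsStrictlyDichotomousWrt (S : X →ₗ.[ℂ] X) (Xp Xm : Submodule ℂ X) : Prop extends
    S.IsDichotomousWrt Xp Xm where
  bdd_pos : ∃ C : ℝ, ∀ z : ℂ, z.re ≤ 0 → ‖opResolvent (S.restrictTo Xp inv_pos) z‖ ≤ C
  bdd_neg : ∃ C : ℝ, ∀ z : ℂ, 0 ≤ z.re → ‖opResolvent (S.restrictTo Xm inv_neg) z‖ ≤ C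

/-- `S` is strictly dichotomous with respect to some decomposition of `X`. -/
def IsStrictlyDichotomous (S : X →ₗ.[ℂ] X) : Prop :=
  ∃ Xp Xm : Submodule ℂ X, S.IsStrictlyDichotomousWrt Xp Xm

/-- `S` is bisectorial. -/
def IsBisectorial (S : X →ₗ.[ℂ] X) : Prop :=
  {z : ℂ | z.re = 0 ∧ z ≠ 0} ⊆ opResolventSet S ∧
    ∃ M : ℝ, ∀ z : ℂ, z.re = 0 → z ≠ 0 → ‖S.opResolvent z‖ ≤ M / ‖z‖

/-- `S` is almost bisectorial with exponent `β`, where `0 < β < 1`. -/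
def IsAlmostBisectorialWith (S : X →ₗ.[ℂ] X) (β : ℝ) : Prop :=
  (0 < β ∧ β < 1) ∧ {z : ℂ | z.re = 0 ∧ z ≠ 0} ⊆ opResolventSet S ∧
    ∃ M : ℝ, ∀ z : ℂ, z.re = 0 → z ≠ 0 → ‖S.opResolvent z‖ ≤ M / ‖z‖ ^ β

end

end LinearPMap

/-! Write `R(z)` for the resolvent of `T` and `A(z) = (2π)⁻¹ ∫ (iτ - z)⁻¹ R(iτ) dτ`
(`axisTransform`). Decay of `R` along the axis makes the integral converge for `Re z ≠ 0`, boundedly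
away from the axis. For `u ∈ D(T)` the vector `A(z)(T - z)u` is constant on each half-plane: it is
`P u := A(-1)(T + 1)u` on the left and `P u - u` on the right. So `A(z)` plays the role of `(T -
z)⁻¹ P` on the left and of `-(T - z)⁻¹(1 - P)` on the right, where `P` is a possibly unbounded
spectral projection with domain `D(T)`.

Given the decay, boundedness of `P` is the whole question. If the operator is strictly dichotomous,
`P` is the bounded projection onto `X₊` along `X₋` (`IsStrictlyDichotomousWrt.exists_projection`).
Conversely, if `P` is bounded, its extension splits `X`, and `R(z)` near the axis together with
`±A(z)` far from it gives the resolvents of the two parts (`HasAxisDecay.isStrictlyDichotomousWrt`).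
The tool for both is a Liouville argument, `HasAxisDecay.eq_zero_of_solves`.

On `D(S) ∩ D(T)` the projections of `S` and `T` differ by `(2π)⁻¹ ∫ (R_S - R_T)(iτ) dτ`, a bounded
operator because the exponent `1 + ε` exceeds 1. So the projection of `T` is bounded on a dense
subspace, hence on `D(T)` by a closedness argument. The resolvent estimates for `T` follow from the
triangle inequality. -/

open Complex MeasureTheory Filter Topology

namespace LinearPMap

/-! ### Resolvents of unbounded operators. -/

section Resolvent

variable {X : Type*} [NormedAddCommGroup X] [NormedSpace ℂ X] {T : X →ₗ.[ℂ] X}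

theorem IsResolventAt.opResolvent_eq {z : ℂ} {R : X →L[ℂ] X} (h : T.IsResolventAt z R) :
    T.opResolvent z = R := by
  have hex : ∃ R : X →L[ℂ] X, T.IsResolventAt z R := ⟨R, h⟩
  rw [opResolvent, dif_pos hex]
  exact hex.choose_spec.unique h

theorem isResolventAt_opResolvent {z : ℂ} (h : z ∈ T.opResolventSet) :
    T.IsResolventAt z (T.opResolvent z) := by
  obtain ⟨R, hR⟩ := h
  rwa [hR.opResolvent_eq]

/-- The vector `u` solves `(T - z) u = y`. -/
def Solves (T : X →ₗ.[ℂ] X) (z : ℂ) (u y : X) : Prop :=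
  ∃ h : u ∈ T.domain, T ⟨u, h⟩ = y + z • u

theorem Solves.add {z : ℂ} {u v x y : X} (h : T.Solves z u x) (h' : T.Solves z v y) :
    T.Solves z (u + v) (x + y) := by
  obtain ⟨hu, hx⟩ := h
  obtain ⟨hv, hy⟩ := h'
  refine ⟨T.domain.add_mem hu hv, ?_⟩
  have := T.map_add ⟨u, hu⟩ ⟨v, hv⟩
  rw [hx, hy] at this
  rw [smul_add, add_add_add_comm, ← this]
  rfl

theorem Solves.neg {z : ℂ} {u x : X} (h : T.Solves z u x) : T.Solves z (-u) (-x) := by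
  obtain ⟨hu, hx⟩ := h
  refine ⟨T.domain.neg_mem hu, ?_⟩
  have := T.map_neg ⟨u, hu⟩
  rw [hx] at this
  rw [smul_neg, ← neg_add, ← this]
  rfl

theorem Solves.sub {z : ℂ} {u v x y : X} (h : T.Solves z u x) (h' : T.Solves z v y) :
    T.Solves z (u - v) (x - y) := by
  simpa [sub_eq_add_neg] using h.add h'.neg

theorem IsResolventAt.solves {z : ℂ} {R : X →L[ℂ] X} (h : T.IsResolventAt z R) (x : X) :
    T.Solves z (R x) x := by
  obtain ⟨hx, e⟩ := h.1 x
  exact ⟨hx, sub_eq_iff_eq_add.1 e⟩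

theorem Solves.eq_of_isResolventAt {z : ℂ} {u y : X} {R : X →L[ℂ] X} (h : T.Solves z u y)
    (hR : T.IsResolventAt z R) : u = R y := by
  obtain ⟨hu, e⟩ := h
  have := hR.2 ⟨u, hu⟩
  rw [e, add_sub_cancel_right] at this
  exact this.symm

theorem Solves.shift {z w : ℂ} {u y : X} (h : T.Solves z u y) :
    T.Solves w u (y + (z - w) • u) := by
  obtain ⟨hu, e⟩ := h
  refine ⟨hu, ?_⟩
  rw [e, sub_smul]
  abel

theorem IsResolventAt.of_solves {z : ℂ} {R : X →L[ℂ] X} (h : ∀ x, T.Solves z (R x) x)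
    (h' : ∀ u y, T.Solves z u y → R y = u) : T.IsResolventAt z R := by
  refine ⟨fun x => ?_, fun x => h' _ _ ⟨x.2, by simp⟩⟩
  obtain ⟨hx, e⟩ := h x
  exact ⟨hx, sub_eq_iff_eq_add.2 e⟩

/-- The first resolvent identity. -/
theorem IsResolventAt.sub_eq {z w : ℂ} {R R' : X →L[ℂ] X} (h : T.IsResolventAt z R)
    (h' : T.IsResolventAt w R') : R' - R = (w - z) • (R' ∘L R) := by
  ext x
  have := ((h.solves x).shift (w := w)).eq_of_isResolventAt h'
  rw [R'.map_add, R'.map_smul] at this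
  change R' x - R x = (w - z) • R' (R x)
  rw [← neg_sub z w, neg_smul, ← sub_eq_zero, sub_neg_eq_add, sub_add_eq_add_sub, ← this, sub_self]

theorem IsResolventAt.injective {z : ℂ} {R : X →L[ℂ] X} (h : T.IsResolventAt z R) {x : X}
    (hx : R x = 0) : x = 0 := by
  obtain ⟨hm, e⟩ := h.solves x
  have h0 : (⟨R x, hm⟩ : T.domain) = 0 := Subtype.ext hx
  rw [h0, T.map_zero, hx, smul_zero, add_zero] at e
  exact e.symm

/-- A bounded operator which commutes with one resolvent maps solutions to solutions. -/
theorem Solves.map_of_commute {z w : ℂ} {R A : X →L[ℂ] X} (hR : T.IsResolventAt w R)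
    (hA : Commute A R) {u y : X} (h : T.Solves z u y) : T.Solves z (A u) (A y) := by
  have h1 := (h.shift (w := w)).eq_of_isResolventAt hR
  have h2 : A u = R (A (y + (z - w) • u)) := by
    conv_lhs => rw [h1]
    exact DFunLike.congr_fun hA.eq (y + (z - w) • u)
  have h3 := (hR.solves (A (y + (z - w) • u))).shift (w := z)
  rw [← h2] at h3
  convert h3 using 1
  rw [A.map_add, A.map_smul, ← neg_sub z w, neg_smul]
  abel

/-- A bounded operator which commutes with one resolvent commutes with all of them. -/
theorem IsResolventAt.commute {z w : ℂ} {R R' A : X →L[ℂ] X} (hR : T.IsResolventAt w R)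
    (hR' : T.IsResolventAt z R') (hA : Commute A R) : Commute A R' := by
  ext x
  exact ((hR'.solves x).map_of_commute hR hA).eq_of_isResolventAt hR'

variable [CompleteSpace X]

/-- Perturbation of the spectral parameter by a Neumann series. -/
theorem IsResolventAt.exists_near {z w : ℂ} {R : X →L[ℂ] X} {K : ℝ} (h : T.IsResolventAt z R)
    (hK : ‖R‖ ≤ K) (hw : ‖w - z‖ * K ≤ 1 / 2) :
    ∃ R', T.IsResolventAt w R' ∧ ‖R'‖ ≤ 2 * K := by
  have hK0 : 0 ≤ K := (norm_nonneg R).trans hK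
  have hs : ‖(w - z) • R‖ ≤ 1 / 2 := by
    rw [norm_smul]
    exact (mul_le_mul_of_nonneg_left hK (norm_nonneg _)).trans hw
  -- On the domain `T - w = (1 - (w - z) R)(T - z)`, so the resolvent at `w` is `R N⁻¹`; the bound
  -- 1/2 gives `‖N⁻¹‖ ≤ 2`.
  set N : (X →L[ℂ] X)ˣ := Units.oneSub ((w - z) • R) (by linarith) with hN
  have hNv : (N : X →L[ℂ] X) = 1 - (w - z) • R := rfl
  have hcomm : Commute ((N⁻¹ : (X →L[ℂ] X)ˣ) : X →L[ℂ] X) R := by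
    apply Commute.units_inv_left
    rw [hNv]
    exact (Commute.one_left R).sub_left ((Commute.refl R).smul_left _)
  have hmul : ∀ x, N⁻¹.1 x - (w - z) • R (N⁻¹.1 x) = x := fun x => by
    have := DFunLike.congr_fun N.mul_inv x
    rw [hNv] at this
    simpa using this
  have hinv : ∀ x, N⁻¹.1 (x - (w - z) • R x) = x := fun x => by
    have := DFunLike.congr_fun N.inv_mul x
    rw [hNv] at this
    simpa using this
  refine ⟨R * N⁻¹.1, IsResolventAt.of_solves (fun x => ?_) (fun u y hu => ?_), ?_⟩
  · have := (h.solves (N⁻¹.1 x)).shift (w := w)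
    rwa [← neg_sub w z, neg_smul, ← sub_eq_add_neg, hmul x] at this
  · have h1 := (hu.shift (w := z)).eq_of_isResolventAt h
    rw [← hcomm.eq]
    change N⁻¹.1 (R y) = u
    conv_rhs => rw [← hinv u]
    congr 1
    conv_rhs => enter [1]; rw [h1]
    simp
  · have hN1 : ‖N⁻¹.1‖ ≤ 2 := by
      refine ContinuousLinearMap.opNorm_le_bound _ (by norm_num) fun x => ?_
      have h1 := hmul x
      have h2 : ‖((w - z) • R) (N⁻¹.1 x)‖ ≤ 1 / 2 * ‖N⁻¹.1 x‖ :=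
        (ContinuousLinearMap.le_opNorm _ _).trans
          (mul_le_mul_of_nonneg_right hs (norm_nonneg _))
      have h3 : ‖N⁻¹.1 x‖ - ‖((w - z) • R) (N⁻¹.1 x)‖ ≤ ‖x‖ := by
        conv_rhs => rw [← h1]
        exact norm_sub_norm_le _ _
      linarith
    calc ‖R * N⁻¹.1‖ ≤ ‖R‖ * ‖N⁻¹.1‖ := norm_mul_le _ _
      _ ≤ K * 2 := mul_le_mul hK hN1 (norm_nonneg _) hK0
      _ = 2 * K := mul_comm _ _

theorem eventually_opResolvent {z : ℂ} (hz : z ∈ T.opResolventSet) :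
    ∃ C, ∀ᶠ w in 𝓝 z, w ∈ T.opResolventSet ∧ ‖T.opResolvent w‖ ≤ C := by
  have h := isResolventAt_opResolvent hz
  refine ⟨2 * ‖T.opResolvent z‖, ?_⟩
  have ht : Tendsto (fun w : ℂ => ‖w - z‖ * ‖T.opResolvent z‖) (𝓝 z) (𝓝 0) := by
    have : Continuous (fun w : ℂ => ‖w - z‖ * ‖T.opResolvent z‖) := by fun_prop
    simpa using this.tendsto z
  filter_upwards [ht.eventually (ge_mem_nhds (show (0 : ℝ) < 1 / 2 by norm_num))] with w hw
  obtain ⟨R', hR', hb⟩ := h.exists_near le_rfl hw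
  exact ⟨⟨R', hR'⟩, by rwa [hR'.opResolvent_eq]⟩

theorem continuousAt_opResolvent {z : ℂ} (hz : z ∈ T.opResolventSet) :
    ContinuousAt T.opResolvent z := by
  obtain ⟨C, hC⟩ := eventually_opResolvent hz
  have h := isResolventAt_opResolvent hz
  rw [ContinuousAt, tendsto_iff_norm_sub_tendsto_zero]
  have ht : Tendsto (fun w : ℂ => ‖w - z‖ * (C * ‖T.opResolvent z‖)) (𝓝 z) (𝓝 0) := by
    have : Continuous (fun w : ℂ => ‖w - z‖ * (C * ‖T.opResolvent z‖)) := by fun_prop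
    simpa using this.tendsto z
  refine squeeze_zero' (Eventually.of_forall fun _ => norm_nonneg _) ?_ ht
  filter_upwards [hC] with w hw
  rw [h.sub_eq (isResolventAt_opResolvent hw.1), norm_smul]
  gcongr
  exact (ContinuousLinearMap.opNorm_comp_le _ _).trans (by gcongr; exact hw.2)

theorem differentiableAt_opResolvent {z : ℂ} (hz : z ∈ T.opResolventSet) :
    DifferentiableAt ℂ T.opResolvent z := by
  obtain ⟨C, hC⟩ := eventually_opResolvent hz
  have h := isResolventAt_opResolvent hz
  refine HasDerivAt.differentiableAt (f' := T.opResolvent z * T.opResolvent z) ?_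
  rw [hasDerivAt_iff_tendsto_slope]
  have hc : Tendsto (fun w => T.opResolvent w * T.opResolvent z) (𝓝[≠] z)
      (𝓝 (T.opResolvent z * T.opResolvent z)) :=
    ((continuousAt_opResolvent hz).tendsto.mono_left nhdsWithin_le_nhds).mul_const _
  refine hc.congr' ?_
  filter_upwards [nhdsWithin_le_nhds hC, self_mem_nhdsWithin] with w hw hne
  rw [slope_def_module, h.sub_eq (isResolventAt_opResolvent hw.1), smul_smul,
    inv_mul_cancel₀ (sub_ne_zero.2 hne), one_smul]
  rfl

theorem continuous_opResolvent_axis (hT : {z : ℂ | z.re = 0} ⊆ T.opResolventSet) :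
    Continuous (fun τ : ℝ => T.opResolvent ((τ : ℂ) * I)) := by
  rw [continuous_iff_continuousAt]
  intro τ
  have h : ContinuousAt (fun τ : ℝ => (τ : ℂ) * I) τ := by fun_prop
  exact ContinuousAt.comp (f := fun τ : ℝ => (τ : ℂ) * I)
    (continuousAt_opResolvent (hT (by simp))) h

end Resolvent

end LinearPMap

/-! ### The Cauchy kernel of the imaginary axis. -/

section Kernel

theorem axis_sub_ne_zero {z : ℂ} (hz : z.re ≠ 0) (τ : ℝ) : (τ : ℂ) * I - z ≠ 0 := by
  intro h
  apply hz
  simpa using congrArg Complex.re h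

theorem le_norm_axis_sub {z : ℂ} {h : ℝ} (hz : h ≤ |z.re|) (τ : ℝ) :
    min h 1 / 2 * (1 + |τ - z.im|) ≤ ‖(τ : ℂ) * I - z‖ := by
  have h1 : |z.re| ≤ ‖(τ : ℂ) * I - z‖ := by
    simpa using Complex.abs_re_le_norm ((τ : ℂ) * I - z)
  have h2 : |τ - z.im| ≤ ‖(τ : ℂ) * I - z‖ := by
    simpa using Complex.abs_im_le_norm ((τ : ℂ) * I - z)
  have h3 : min h 1 ≤ h := min_le_left _ _
  have h4 : min h 1 ≤ 1 := min_le_right _ _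
  have h5 : min h 1 * |τ - z.im| ≤ 1 * |τ - z.im| :=
    mul_le_mul_of_nonneg_right h4 (abs_nonneg _)
  linarith

/-- Replace the larger of `u`, `v` by the smaller. The product of two decays centred at different
points is thus bounded by a sum whose integral does not depend on the distance of the centres, which
makes later bounds uniform in `Im z`. -/
theorem rpow_neg_mul_inv_le {u v β : ℝ} (hu : 0 < u) (hv : 0 < v) (hβ : 0 ≤ β) :
    u ^ (-β) * v⁻¹ ≤ u ^ (-(1 + β)) + v ^ (-(1 + β)) := by
  have key : ∀ w : ℝ, 0 < w → w ^ (-(1 + β)) = w ^ (-β) * w⁻¹ := fun w hw => by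
    rw [neg_add_rev, Real.rpow_add hw, Real.rpow_neg_one]
  have pos : ∀ w : ℝ, 0 < w → 0 ≤ w ^ (-(1 + β)) := fun w hw => (Real.rpow_pos_of_pos hw _).le
  rcases le_total u v with h | h
  · have : u ^ (-β) * v⁻¹ ≤ u ^ (-(1 + β)) := by
      rw [key u hu]
      gcongr
    linarith [pos v hv]
  · have : u ^ (-β) * v⁻¹ ≤ v ^ (-(1 + β)) := by
      rw [key v hv]
      exact mul_le_mul_of_nonneg_right
        (Real.rpow_le_rpow_of_nonpos hv h (neg_nonpos.2 hβ)) (inv_nonneg.2 hv.le)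
    linarith [pos u hu]

/-- An integrable majorant of the product of the Cauchy kernel of the imaginary axis and a
function decaying with exponent `β`. -/
noncomputable def axisMajorant (β b : ℝ) (τ : ℝ) : ℝ :=
  (1 + ‖τ‖) ^ (-(1 + β)) + (1 + ‖τ - b‖) ^ (-(1 + β))

theorem integrable_one_add_abs_rpow {β : ℝ} (hβ : 0 < β) :
    Integrable (fun τ : ℝ => (1 + ‖τ‖) ^ (-(1 + β))) :=
  integrable_one_add_norm (by simpa using hβ)

theorem integrable_axisMajorant {β : ℝ} (hβ : 0 < β) (b : ℝ) : Integrable (axisMajorant β b) :=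
  (integrable_one_add_abs_rpow hβ).add ((integrable_one_add_abs_rpow hβ).comp_sub_right b)

theorem integral_axisMajorant {β : ℝ} (hβ : 0 < β) (b : ℝ) :
    ∫ τ, axisMajorant β b τ = 2 * ∫ τ : ℝ, (1 + ‖τ‖) ^ (-(1 + β)) := by
  unfold axisMajorant
  rw [integral_add (integrable_one_add_abs_rpow hβ)
    ((integrable_one_add_abs_rpow hβ).comp_sub_right b),
    integral_sub_right_eq_self (fun τ : ℝ => (1 + ‖τ‖) ^ (-(1 + β))), two_mul]

variable {E : Type*} [NormedAddCommGroup E] [NormedSpace ℂ E]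

theorem norm_kernel_smul_le {f : ℝ → E} {K β : ℝ} (hβ : 0 < β) (hK : 0 ≤ K)
    (hf : ∀ τ, ‖f τ‖ ≤ K * (1 + |τ|) ^ (-β)) {z : ℂ} {h : ℝ} (hh : 0 < h) (hz : h ≤ |z.re|)
    (τ : ℝ) : ‖((τ : ℂ) * I - z)⁻¹ • f τ‖ ≤ 2 / min h 1 * K * axisMajorant β z.im τ := by
  have hm : 0 < min h 1 := lt_min hh one_pos
  have hv : 0 < 1 + |τ - z.im| := by positivity
  have hu : 0 < 1 + |τ| := by positivity
  have h1 : ‖((τ : ℂ) * I - z)⁻¹‖ ≤ 2 / min h 1 * (1 + |τ - z.im|)⁻¹ := by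
    rw [norm_inv]
    calc ‖(τ : ℂ) * I - z‖⁻¹ ≤ (min h 1 / 2 * (1 + |τ - z.im|))⁻¹ :=
          inv_anti₀ (by positivity) (le_norm_axis_sub hz τ)
      _ = 2 / min h 1 * (1 + |τ - z.im|)⁻¹ := by rw [mul_inv, inv_div]
  calc ‖((τ : ℂ) * I - z)⁻¹ • f τ‖
      ≤ (2 / min h 1 * (1 + |τ - z.im|)⁻¹) * (K * (1 + |τ|) ^ (-β)) := by
        rw [norm_smul]
        exact mul_le_mul h1 (hf τ) (norm_nonneg _) (by positivity)
    _ = 2 / min h 1 * K * ((1 + |τ|) ^ (-β) * (1 + |τ - z.im|)⁻¹) := by ring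
    _ ≤ 2 / min h 1 * K * axisMajorant β z.im τ := by
        gcongr
        exact rpow_neg_mul_inv_le hu hv hβ.le

theorem continuous_kernel {z : ℂ} (hz : z.re ≠ 0) :
    Continuous (fun τ : ℝ => ((τ : ℂ) * I - z)⁻¹) :=
  Continuous.inv₀ (by fun_prop) (axis_sub_ne_zero hz)

theorem integrable_kernel_smul {f : ℝ → E} (hc : Continuous f) {K β : ℝ} (hβ : 0 < β)
    (hf : ∀ τ, ‖f τ‖ ≤ K * (1 + |τ|) ^ (-β)) {z : ℂ} (hz : z.re ≠ 0) :
    Integrable (fun τ : ℝ => ((τ : ℂ) * I - z)⁻¹ • f τ) := by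
  have hK : 0 ≤ K := by simpa using (norm_nonneg _).trans (hf 0)
  exact ((integrable_axisMajorant hβ z.im).const_mul _).mono'
    ((continuous_kernel hz).smul hc).aestronglyMeasurable
    (Eventually.of_forall (norm_kernel_smul_le hβ hK hf (abs_pos.2 hz) le_rfl))

theorem norm_integral_kernel_smul_le {f : ℝ → E} {K β : ℝ} (hβ : 0 < β)
    (hf : ∀ τ, ‖f τ‖ ≤ K * (1 + |τ|) ^ (-β)) {z : ℂ} {h : ℝ} (hh : 0 < h) (hz : h ≤ |z.re|) :
    ‖∫ τ : ℝ, ((τ : ℂ) * I - z)⁻¹ • f τ‖ ≤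
      2 / min h 1 * K * (2 * ∫ τ : ℝ, (1 + ‖τ‖) ^ (-(1 + β))) := by
  have hK : 0 ≤ K := by simpa using (norm_nonneg _).trans (hf 0)
  rw [← integral_axisMajorant hβ z.im, ← integral_const_mul]
  exact norm_integral_le_of_norm_le ((integrable_axisMajorant hβ z.im).const_mul _)
    (Eventually.of_forall (norm_kernel_smul_le hβ hK hf hh hz))

/-- The Cauchy transform of a decaying function on the imaginary axis is holomorphic off the
axis. -/
theorem differentiableAt_integral_kernel_smul {f : ℝ → E} (hc : Continuous f) {K β : ℝ}
    (hβ : 0 < β) (hf : ∀ τ, ‖f τ‖ ≤ K * (1 + |τ|) ^ (-β)) {z : ℂ} (hz : z.re ≠ 0) :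
    DifferentiableAt ℂ (fun w : ℂ => ∫ τ : ℝ, ((τ : ℂ) * I - w)⁻¹ • f τ) z := by
  have hr : 0 < |z.re| / 2 := by have := abs_pos.2 hz; positivity
  have hfar : ∀ τ : ℝ, ∀ w ∈ Metric.ball z (|z.re| / 2),
      ‖(τ : ℂ) * I - z‖ / 2 ≤ ‖(τ : ℂ) * I - w‖ := fun τ w hw => by
    have h1 : |z.re| ≤ ‖(τ : ℂ) * I - z‖ := by
      simpa using Complex.abs_re_le_norm ((τ : ℂ) * I - z)
    have h2 : ‖w - z‖ < |z.re| / 2 := by simpa [dist_eq_norm] using hw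
    have h3 : ‖(τ : ℂ) * I - z‖ ≤ ‖(τ : ℂ) * I - w‖ + ‖w - z‖ := by
      simpa using norm_add_le ((τ : ℂ) * I - w) (w - z)
    linarith
  have hpos : ∀ τ : ℝ, |z.re| ≤ ‖(τ : ℂ) * I - z‖ := fun τ => by
    simpa using Complex.abs_re_le_norm ((τ : ℂ) * I - z)
  have hne : ∀ τ : ℝ, ∀ w ∈ Metric.ball z (|z.re| / 2), (τ : ℂ) * I - w ≠ 0 := fun τ w hw => by
    have := hfar τ w hw
    have := hpos τ
    exact norm_pos_iff.1 (by linarith)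
  -- On this ball `|iτ - w| ≥ |iτ - z| / 2`. Of the two factors in the differentiated kernel, one is
  -- at most `2 / |Re z|` and the other at most twice the kernel at `z`, hence the 4.
  refine (hasDerivAt_integral_of_dominated_loc_of_deriv_le
    (F' := fun w (τ : ℝ) => (((τ : ℂ) * I - w) ^ 2)⁻¹ • f τ)
    (bound := fun τ : ℝ => 4 / |z.re| * ‖((τ : ℂ) * I - z)⁻¹ • f τ‖)
    (Metric.ball_mem_nhds z hr) ?_
    (integrable_kernel_smul hc hβ hf hz) ?_ ?_ ?_ ?_).2.differentiableAt
  · have : ∀ᶠ w in 𝓝 z, w.re ≠ 0 := Complex.continuous_re.continuousAt.eventually_ne hz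
    filter_upwards [this] with w hw
    exact ((continuous_kernel hw).smul hc).aestronglyMeasurable
  · refine (Continuous.smul ?_ hc).aestronglyMeasurable
    exact Continuous.inv₀ (by fun_prop) fun τ => pow_ne_zero 2 (axis_sub_ne_zero hz τ)
  · refine Eventually.of_forall fun τ w hw => ?_
    rw [norm_smul, norm_smul, ← mul_assoc]
    gcongr
    rw [norm_inv, norm_inv, norm_pow]
    have h1 := hfar τ w hw
    have h2 := hpos τ
    have h0 : 0 < |z.re| := abs_pos.2 hz
    have h3 : 0 < ‖(τ : ℂ) * I - z‖ := by linarith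
    calc (‖(τ : ℂ) * I - w‖ ^ 2)⁻¹ ≤ (|z.re| / 2 * (‖(τ : ℂ) * I - z‖ / 2))⁻¹ := by
          apply inv_anti₀ (by positivity)
          rw [sq]
          exact mul_le_mul (by linarith) h1 (by positivity) (by positivity)
      _ = 4 / |z.re| * ‖(τ : ℂ) * I - z‖⁻¹ := by
          field_simp
          norm_num
  · exact (integrable_kernel_smul hc hβ hf hz).norm.const_mul _
  · refine Eventually.of_forall fun τ w hw => HasDerivAt.smul_const ?_ (f τ)
    have h1 : HasDerivAt (fun w : ℂ => (τ : ℂ) * I - w) (-1) w := by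
      simpa using (hasDerivAt_id w).const_sub ((τ : ℂ) * I)
    convert h1.fun_inv (hne τ w hw) using 1
    rw [neg_neg, one_div]

theorem norm_kernel_ofReal_le {s : ℝ} (hs : s ≠ 0) (τ : ℝ) :
    ‖((τ : ℂ) * I - s)⁻¹‖ ≤ 2 / min |s| 1 * (1 + |τ|) ^ (-1 : ℝ) := by
  have hm : 0 < min |s| 1 := lt_min (abs_pos.2 hs) one_pos
  have h := le_norm_axis_sub (z := s) (h := |s|) (by simp) τ
  rw [Complex.ofReal_im, sub_zero] at h
  rw [norm_inv, Real.rpow_neg_one]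
  calc ‖(τ : ℂ) * I - s‖⁻¹ ≤ (min |s| 1 / 2 * (1 + |τ|))⁻¹ := inv_anti₀ (by positivity) h
    _ = 2 / min |s| 1 * (1 + |τ|)⁻¹ := by rw [mul_inv, inv_div]

theorem kernel_sub_kernel {z w : ℂ} (hz : z.re ≠ 0) (hw : w.re ≠ 0) (τ : ℝ) :
    ((τ : ℂ) * I - z)⁻¹ - ((τ : ℂ) * I - w)⁻¹ =
      (z - w) * (((τ : ℂ) * I - z)⁻¹ • ((τ : ℂ) * I - w)⁻¹) := by
  have h1 := axis_sub_ne_zero hz τ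
  have h2 := axis_sub_ne_zero hw τ
  rw [smul_eq_mul]
  field_simp
  ring

theorem integrable_kernel_sub {z : ℂ} (hz : z.re ≠ 0) {s : ℝ} (hs : s ≠ 0) :
    Integrable (fun τ : ℝ => ((τ : ℂ) * I - z)⁻¹ - ((τ : ℂ) * I - s)⁻¹) := by
  have hs' : (s : ℂ).re ≠ 0 := by simpa using hs
  simp_rw [kernel_sub_kernel hz hs']
  exact (integrable_kernel_smul (continuous_kernel hs') one_pos
    (norm_kernel_ofReal_le hs) hz).const_mul _

theorem tendsto_kernel_quotient (z w : ℂ) (hw : w.re ≠ 0) {l : Filter ℝ}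
    (hl : Tendsto (fun τ : ℝ => |τ|) l atTop) :
    Tendsto (fun τ : ℝ => ((τ : ℂ) * I - z) / ((τ : ℂ) * I - w)) l (𝓝 1) := by
  have h1 : ∀ τ : ℝ, ((τ : ℂ) * I - z) / ((τ : ℂ) * I - w) =
      1 + (w - z) * ((τ : ℂ) * I - w)⁻¹ := fun τ => by
    have := axis_sub_ne_zero hw τ
    field_simp
    ring
  simp_rw [h1]
  have h2 : Tendsto (fun τ : ℝ => ((τ : ℂ) * I - w)⁻¹) l (𝓝 0) := by
    rw [tendsto_zero_iff_norm_tendsto_zero]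
    simp_rw [norm_inv]
    refine Tendsto.inv_tendsto_atTop ?_
    refine tendsto_atTop_mono (fun τ => ?_) (tendsto_atTop_add_const_right l (-‖w‖) hl)
    have := norm_sub_norm_le ((τ : ℂ) * I) w
    simp only [norm_mul, Complex.norm_real, Complex.norm_I, mul_one, Real.norm_eq_abs] at this
    linarith
  simpa using (h2.const_mul (w - z)).const_add 1

/-- If the quotient were a real `q ≤ 0`, real parts would give `Re z = q Re w`, hence `Re z · Re w ≤
0`. -/
theorem kernel_quotient_mem_slitPlane {z w : ℂ} (h : 0 < z.re * w.re) (τ : ℝ) :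
    ((τ : ℂ) * I - z) / ((τ : ℂ) * I - w) ∈ slitPlane := by
  have hw : w.re ≠ 0 := fun h0 => by simp [h0] at h
  by_contra hq
  rw [Complex.mem_slitPlane_iff, not_or, not_lt, not_not] at hq
  set q := ((τ : ℂ) * I - z) / ((τ : ℂ) * I - w) with hqdef
  have hmul : (τ : ℂ) * I - z = q * ((τ : ℂ) * I - w) :=
    (div_mul_cancel₀ _ (axis_sub_ne_zero hw τ)).symm
  have hre := congrArg Complex.re hmul
  simp [Complex.mul_re, hq.2] at hre
  rw [hre] at h
  nlinarith [mul_self_nonneg w.re]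

/-- Up to the factor `I`, a primitive is the logarithm of the quotient `(iτ - s) / (iτ - z)` or its
inverse. For two points on the same side this quotient avoids the slit, and it tends to 1 at both
ends. -/
theorem integral_kernel_sub {z : ℂ} {s : ℝ} (h : 0 < z.re * s) :
    ∫ τ : ℝ, (((τ : ℂ) * I - z)⁻¹ - ((τ : ℂ) * I - s)⁻¹) = 0 := by
  have hz : z.re ≠ 0 := fun h0 => by simp [h0] at h
  have hs : s ≠ 0 := fun h0 => by simp [h0] at h
  have hs' : (s : ℂ).re ≠ 0 := by simpa using hs
  have hderiv : ∀ τ : ℝ, HasDerivAt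
      (fun τ : ℝ => Complex.log (((τ : ℂ) * I - z) / ((τ : ℂ) * I - s)))
      (I * (((τ : ℂ) * I - z)⁻¹ - ((τ : ℂ) * I - s)⁻¹)) τ := fun τ => by
    have h1 := axis_sub_ne_zero hz τ
    have h2 := axis_sub_ne_zero hs' τ
    have hl : ∀ w : ℂ, HasDerivAt (fun τ : ℝ => (τ : ℂ) * I - w) I τ := fun w => by
      simpa using ((hasDerivAt_id τ).ofReal_comp.mul_const I).sub_const w
    convert ((hl z).fun_div (hl s) h2).clog_real
      (kernel_quotient_mem_slitPlane (by simpa using h) τ) using 1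
    generalize (τ : ℂ) * I - z = a at h1
    generalize (τ : ℂ) * I - s = b at h2
    field_simp
  have hlim : ∀ l : Filter ℝ, Tendsto (fun τ : ℝ => |τ|) l atTop →
      Tendsto (fun τ : ℝ => Complex.log (((τ : ℂ) * I - z) / ((τ : ℂ) * I - s))) l (𝓝 0) :=
    fun l hl => by
      have := (tendsto_kernel_quotient z s hs' hl).clog (by simp)
      simpa using this
  have := integral_of_hasDerivAt_of_tendsto hderiv ((integrable_kernel_sub hz hs).const_mul I)
    (hlim _ tendsto_abs_atBot_atTop) (hlim _ tendsto_abs_atTop_atTop)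
  rw [integral_const_mul, sub_zero] at this
  exact (mul_eq_zero.1 this).resolve_left I_ne_zero

/-- The integrand is `-2 / (1 + τ²)`. This is the jump of the Cauchy integral across the axis and
fixes the normalisation `1 / 2π`. -/
theorem integral_kernel_one_sub_neg_one :
    ∫ τ : ℝ, (((τ : ℂ) * I - (1 : ℝ))⁻¹ - ((τ : ℂ) * I - (-1 : ℝ))⁻¹) = -(2 * Real.pi : ℝ) := by
  have h : ∀ τ : ℝ, ((τ : ℂ) * I - (1 : ℝ))⁻¹ - ((τ : ℂ) * I - (-1 : ℝ))⁻¹ =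
      ((-2 * (1 + τ ^ 2)⁻¹ : ℝ) : ℂ) := fun τ => by
    have h1 := axis_sub_ne_zero (z := (1 : ℝ)) (by simp) τ
    have h2 := axis_sub_ne_zero (z := (-1 : ℝ)) (by simp) τ
    have h3 : (1 + (τ : ℂ) ^ 2) ≠ 0 := by
      have : (0 : ℝ) < 1 + τ ^ 2 := by positivity
      exact_mod_cast this.ne'
    push_cast at *
    field_simp
    ring_nf
    simp only [I_sq]
    ring
  simp_rw [h]
  rw [integral_complex_ofReal, integral_const_mul, integral_univ_inv_one_add_sq]
  push_cast
  ring

end Kernel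

namespace LinearPMap

/-! ### Decay along the axis, the Liouville argument and the Cauchy transform. -/

section AxisTransform

variable {X : Type*} [NormedAddCommGroup X] [NormedSpace ℂ X] {T : X →ₗ.[ℂ] X} {β K : ℝ}

/-- The imaginary axis lies in the resolvent set of `T`, and the resolvent decays along it with
exponent `β`. -/
structure HasAxisDecay (T : X →ₗ.[ℂ] X) (β K : ℝ) : Prop where
  exponent_pos : 0 < β
  mem (τ : ℝ) : (τ : ℂ) * I ∈ T.opResolventSet
  norm_le (τ : ℝ) : ‖T.opResolvent ((τ : ℂ) * I)‖ ≤ K * (1 + |τ|) ^ (-β)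

namespace HasAxisDecay

theorem const_nonneg (hT : T.HasAxisDecay β K) : 0 ≤ K := by
  simpa using (norm_nonneg _).trans (hT.norm_le 0)

theorem norm_le_const (hT : T.HasAxisDecay β K) (τ : ℝ) :
    ‖T.opResolvent ((τ : ℂ) * I)‖ ≤ K := by
  refine (hT.norm_le τ).trans (mul_le_of_le_one_right hT.const_nonneg ?_)
  exact Real.rpow_le_one_of_one_le_of_nonpos (by simp) (neg_nonpos.2 hT.exponent_pos.le)

theorem isResolventAt (hT : T.HasAxisDecay β K) (τ : ℝ) :
    T.IsResolventAt ((τ : ℂ) * I) (T.opResolvent ((τ : ℂ) * I)) :=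
  isResolventAt_opResolvent (hT.mem τ)

theorem isResolventAt_zero (hT : T.HasAxisDecay β K) : T.IsResolventAt 0 (T.opResolvent 0) := by
  simpa using hT.isResolventAt 0

theorem imAxis_subset (hT : T.HasAxisDecay β K) : {z : ℂ | z.re = 0} ⊆ T.opResolventSet :=
  fun z (hz : z.re = 0) => by
    have h := hT.mem z.im
    rwa [show (z.im : ℂ) * I = z from Complex.ext (by simp [hz]) (by simp)] at h

theorem continuous_axis [CompleteSpace X] (hT : T.HasAxisDecay β K) :
    Continuous (fun τ : ℝ => T.opResolvent ((τ : ℂ) * I)) :=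
  continuous_opResolvent_axis hT.imAxis_subset

theorem tendsto_zero (hT : T.HasAxisDecay β K) :
    Tendsto (fun τ : ℝ => T.opResolvent ((τ : ℂ) * I)) atTop (𝓝 0) := by
  refine squeeze_zero_norm hT.norm_le ?_
  have h1 : Tendsto (fun τ : ℝ => 1 + |τ|) atTop atTop :=
    tendsto_atTop_add_const_left _ _ tendsto_abs_atTop_atTop
  simpa using ((tendsto_rpow_neg_atTop hT.exponent_pos).comp h1).const_mul K

variable [CompleteSpace X]

/-- The resolvent extends boundedly to a strip around the imaginary axis. -/
theorem exists_strip (hT : T.HasAxisDecay β K) : ∃ h > 0, ∃ C, ∀ z : ℂ, |z.re| ≤ h →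
    z ∈ T.opResolventSet ∧ ‖T.opResolvent z‖ ≤ C := by
  have hK := hT.const_nonneg
  refine ⟨1 / (2 * (K + 1)), by positivity, 2 * K, fun z hz => ?_⟩
  have hzI : z - (z.im : ℂ) * I = z.re := by
    conv_lhs => enter [1]; rw [← Complex.re_add_im z]
    ring
  obtain ⟨R, hR, hRK⟩ := (hT.isResolventAt z.im).exists_near (w := z) (hT.norm_le_const z.im) (by
    rw [hzI, Complex.norm_real, Real.norm_eq_abs]
    calc |z.re| * K ≤ 1 / (2 * (K + 1)) * (K + 1) :=
          mul_le_mul hz (by linarith) hK (by positivity)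
      _ = 1 / 2 := by field_simp)
  exact ⟨⟨R, hR⟩, by rwa [hR.opResolvent_eq]⟩

/-- If `(T - z) u = y` can be solved by bounded holomorphic functions on both half-planes, then
`y = 0`. -/
theorem eq_zero_of_solves (hT : T.HasAxisDecay β K) {y : X} {F G : ℂ → X}
    (hF : ∀ z : ℂ, z.re < 0 → T.Solves z (F z) y ∧ DifferentiableAt ℂ F z)
    (hFb : ∀ h > 0, ∃ C, ∀ z : ℂ, z.re ≤ -h → ‖F z‖ ≤ C)
    (hG : ∀ z : ℂ, 0 < z.re → T.Solves z (G z) y ∧ DifferentiableAt ℂ G z)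
    (hGb : ∀ h > 0, ∃ C, ∀ z : ℂ, h ≤ z.re → ‖G z‖ ≤ C) : y = 0 := by
  obtain ⟨h, hh, C, hC⟩ := hT.exists_strip
  obtain ⟨CF, hCF⟩ := hFb h hh
  obtain ⟨CG, hCG⟩ := hGb h hh
  set H : ℂ → X := fun z => if z.re < 0 then F z else if 0 < z.re then G z
    else T.opResolvent z y with hH
  have hneg : ∀ z : ℂ, z.re < 0 → H z = F z := fun z hz => if_pos hz
  have hpos : ∀ z : ℂ, 0 < z.re → H z = G z := fun z hz => by
    simp only [hH, if_neg hz.le.not_gt, if_pos hz]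
  -- Uniqueness of solutions forces `F` and `G` to agree with the resolvent in the strip, so the
  -- glued function is holomorphic across the axis.
  have hstrip : ∀ z : ℂ, |z.re| ≤ h → H z = T.opResolvent z y := fun z hz => by
    have hR := isResolventAt_opResolvent (hC z hz).1
    rcases lt_trichotomy z.re 0 with h0 | h0 | h0
    · rw [hneg z h0]
      exact (hF z h0).1.eq_of_isResolventAt hR
    · simp only [hH, h0, lt_self_iff_false, if_false]
    · rw [hpos z h0]
      exact (hG z h0).1.eq_of_isResolventAt hR
  have hdiff : Differentiable ℂ H := fun z => by
    rcases lt_trichotomy z.re 0 with h0 | h0 | h0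
    · refine (hF z h0).2.congr_of_eventuallyEq ?_
      filter_upwards [Complex.continuous_re.continuousAt.eventually_lt_const h0] with w hw
      exact hneg w hw
    · have hz : |z.re| < h := by simpa [h0] using hh
      have hd : DifferentiableAt ℂ (fun z => T.opResolvent z y) z :=
        (differentiableAt_opResolvent (hC z hz.le).1).clm_apply (differentiableAt_const y)
      refine hd.congr_of_eventuallyEq ?_
      have hc : ContinuousAt (fun w : ℂ => |w.re|) z := by fun_prop
      filter_upwards [hc.eventually_lt_const hz] with w hw
      exact hstrip w hw.le
    · refine (hG z h0).2.congr_of_eventuallyEq ?_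
      filter_upwards [Complex.continuous_re.continuousAt.eventually_const_lt h0] with w hw
      exact hpos w hw
  have hbdd : Bornology.IsBounded (Set.range H) := by
    rw [isBounded_iff_forall_norm_le]
    refine ⟨max CF (max CG (C * ‖y‖)), ?_⟩
    rintro _ ⟨z, rfl⟩
    rcases le_or_gt |z.re| h with hz | hz
    · rw [hstrip z hz]
      refine le_max_of_le_right (le_max_of_le_right ?_)
      exact (ContinuousLinearMap.le_opNorm _ _).trans
        (mul_le_mul_of_nonneg_right (hC z hz).2 (norm_nonneg _))
    · rcases lt_abs.1 hz with h1 | h1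
      · rw [hpos z (by linarith)]
        exact le_max_of_le_right (le_max_of_le_left (hCG z h1.le))
      · rw [hneg z (by linarith)]
        exact le_max_of_le_left (hCF z (by linarith))
  -- Liouville makes `H` constant; decay along the axis makes the constant zero, so `T.opResolvent
  -- 0` kills `y`.
  have hconst : ∀ τ : ℝ, T.opResolvent ((τ : ℂ) * I) y = T.opResolvent 0 y := fun τ => by
    rw [← hstrip _ (by simpa using hh.le), ← hstrip 0 (by simpa using hh.le)]
    exact hdiff.apply_eq_apply_of_bounded hbdd _ _
  have hlim : Tendsto (fun τ : ℝ => T.opResolvent ((τ : ℂ) * I) y) atTop (𝓝 0) := by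
    have := ((ContinuousLinearMap.apply ℂ X y).continuous.tendsto 0).comp hT.tendsto_zero
    simpa [Function.comp_def] using this
  simp_rw [hconst] at hlim
  exact hT.isResolventAt_zero.injective (tendsto_nhds_unique tendsto_const_nhds hlim)

end HasAxisDecay

/-- The Cauchy transform over the imaginary axis of the resolvent of `T`. -/
noncomputable def axisTransform (T : X →ₗ.[ℂ] X) (z : ℂ) : X →L[ℂ] X :=
  ((2 * Real.pi : ℝ) : ℂ)⁻¹ • ∫ τ : ℝ, ((τ : ℂ) * I - z)⁻¹ • T.opResolvent ((τ : ℂ) * I)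

theorem ofReal_two_pi_ne_zero : ((2 * Real.pi : ℝ) : ℂ) ≠ 0 := by
  exact_mod_cast Real.two_pi_pos.ne'

namespace HasAxisDecay

theorem kernel_smul_apply (hT : T.HasAxisDecay β K) {z : ℂ} (hz : z.re ≠ 0) {u y : X}
    (h : T.Solves z u y) (τ : ℝ) : ((τ : ℂ) * I - z)⁻¹ • T.opResolvent ((τ : ℂ) * I) y =
      T.opResolvent ((τ : ℂ) * I) u + ((τ : ℂ) * I - z)⁻¹ • u := by
  have h1 := (h.shift (w := (τ : ℂ) * I)).eq_of_isResolventAt (hT.isResolventAt τ)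
  rw [ContinuousLinearMap.map_add, ContinuousLinearMap.map_smul] at h1
  have hne := axis_sub_ne_zero hz τ
  conv_rhs => enter [2]; rw [h1]
  rw [smul_add, smul_smul, ← neg_sub ((τ : ℂ) * I) z, mul_neg, inv_mul_cancel₀ hne, neg_smul,
    one_smul]
  abel

theorem exists_norm_axisTransform_le (hT : T.HasAxisDecay β K) {h : ℝ} (hh : 0 < h) :
    ∃ C, ∀ z : ℂ, h ≤ |z.re| → ‖T.axisTransform z‖ ≤ C :=
  ⟨_, fun z hz => by
    rw [axisTransform, norm_smul]
    exact mul_le_mul_of_nonneg_left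
      (norm_integral_kernel_smul_le hT.exponent_pos hT.norm_le hh hz) (norm_nonneg _)⟩

theorem exists_norm_axisTransform_apply_le (hT : T.HasAxisDecay β K) (x : X) {h : ℝ}
    (hh : 0 < h) : ∃ C, ∀ z : ℂ, h ≤ |z.re| → ‖T.axisTransform z x‖ ≤ C := by
  obtain ⟨C, hC⟩ := hT.exists_norm_axisTransform_le hh
  exact ⟨C * ‖x‖, fun z hz => (ContinuousLinearMap.le_opNorm _ _).trans
    (mul_le_mul_of_nonneg_right (hC z hz) (norm_nonneg _))⟩

variable [CompleteSpace X]

theorem integrable_kernel_smul (hT : T.HasAxisDecay β K) {z : ℂ} (hz : z.re ≠ 0) :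
    Integrable (fun τ : ℝ => ((τ : ℂ) * I - z)⁻¹ • T.opResolvent ((τ : ℂ) * I)) :=
  _root_.integrable_kernel_smul hT.continuous_axis hT.exponent_pos hT.norm_le hz

theorem integrable_kernel_smul_apply (hT : T.HasAxisDecay β K) {z : ℂ} (hz : z.re ≠ 0) (x : X) :
    Integrable (fun τ : ℝ => ((τ : ℂ) * I - z)⁻¹ • T.opResolvent ((τ : ℂ) * I) x) :=
  (hT.integrable_kernel_smul hz).apply_continuousLinearMap x

theorem axisTransform_apply (hT : T.HasAxisDecay β K) {z : ℂ} (hz : z.re ≠ 0) (x : X) :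
    T.axisTransform z x = ((2 * Real.pi : ℝ) : ℂ)⁻¹ •
      ∫ τ : ℝ, ((τ : ℂ) * I - z)⁻¹ • T.opResolvent ((τ : ℂ) * I) x := by
  rw [axisTransform, _root_.smul_apply,
    ContinuousLinearMap.integral_apply (hT.integrable_kernel_smul hz)]
  rfl

theorem differentiableAt_axisTransform (hT : T.HasAxisDecay β K) {z : ℂ} (hz : z.re ≠ 0) :
    DifferentiableAt ℂ T.axisTransform z :=
  (differentiableAt_integral_kernel_smul hT.continuous_axis hT.exponent_pos hT.norm_le
    hz).fun_const_smul _

theorem differentiableAt_axisTransform_apply (hT : T.HasAxisDecay β K) (x : X) {z : ℂ}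
    (hz : z.re ≠ 0) : DifferentiableAt ℂ (fun z => T.axisTransform z x) z :=
  (hT.differentiableAt_axisTransform hz).clm_apply (differentiableAt_const x)

theorem commute_axisTransform (hT : T.HasAxisDecay β K) {A : X →L[ℂ] X}
    (hA : Commute A (T.opResolvent 0)) {z : ℂ} (hz : z.re ≠ 0) :
    Commute A (T.axisTransform z) := by
  ext x
  have hcomm : ∀ τ : ℝ, A (T.opResolvent ((τ : ℂ) * I) x) = T.opResolvent ((τ : ℂ) * I) (A x) :=
    fun τ => DFunLike.congr_fun (hT.isResolventAt_zero.commute (hT.isResolventAt τ) hA).eq x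
  change A (T.axisTransform z x) = T.axisTransform z (A x)
  rw [hT.axisTransform_apply hz, hT.axisTransform_apply hz, A.map_smul,
    ← A.integral_comp_comm (hT.integrable_kernel_smul_apply hz x)]
  simp_rw [A.map_smul, hcomm]

theorem solves_axisTransform (hT : T.HasAxisDecay β K) {z w : ℂ} (hz : z.re ≠ 0) {u y : X}
    (h : T.Solves w u y) : T.Solves w (T.axisTransform z u) (T.axisTransform z y) :=
  h.map_of_commute hT.isResolventAt_zero
    (hT.commute_axisTransform (Commute.refl _) hz).symm

theorem axisTransform_sub (hT : T.HasAxisDecay β K) {z w : ℂ} (hz : z.re ≠ 0) (hw : w.re ≠ 0)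
    {u y y' : X} (h : T.Solves z u y) (h' : T.Solves w u y') :
    T.axisTransform z y - T.axisTransform w y' = ((2 * Real.pi : ℝ) : ℂ)⁻¹ •
      (∫ τ : ℝ, (((τ : ℂ) * I - z)⁻¹ - ((τ : ℂ) * I - w)⁻¹)) • u := by
  rw [hT.axisTransform_apply hz, hT.axisTransform_apply hw, ← smul_sub, ← integral_sub
    (hT.integrable_kernel_smul_apply hz y)
    (hT.integrable_kernel_smul_apply hw y'), ← integral_smul_const]
  congr 2
  ext τ
  rw [hT.kernel_smul_apply hz h, hT.kernel_smul_apply hw h', sub_smul]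
  abel

/-- The common value over the left half-plane is the spectral projection of `u`; the base point `-1`
is an arbitrary choice. -/
theorem axisTransform_of_re_neg (hT : T.HasAxisDecay β K) {z : ℂ} (hz : z.re < 0) {u y y' : X}
    (h : T.Solves z u y) (h' : T.Solves (-1 : ℝ) u y') :
    T.axisTransform z y = T.axisTransform (-1 : ℝ) y' := by
  rw [← sub_eq_zero, hT.axisTransform_sub hz.ne (by simp) h h',
    integral_kernel_sub (by linarith), zero_smul, smul_zero]

theorem axisTransform_of_re_pos (hT : T.HasAxisDecay β K) {z : ℂ} (hz : 0 < z.re) {u y y' : X}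
    (h : T.Solves z u y) (h' : T.Solves (-1 : ℝ) u y') :
    T.axisTransform z y = T.axisTransform (-1 : ℝ) y' - u := by
  have h1 := h.shift (w := (1 : ℝ))
  -- Move from `z` to `1` within the right half-plane at no cost, then jump from `1` to `-1`, which
  -- contributes `-u`.
  have e1 := hT.axisTransform_sub hz.ne' (by simp) h h1
  have e2 := hT.axisTransform_sub (by simp) (by simp) h1 h'
  rw [integral_kernel_sub (by linarith), zero_smul, smul_zero, sub_eq_zero] at e1
  rw [integral_kernel_one_sub_neg_one, smul_smul, mul_neg, inv_mul_cancel₀ ofReal_two_pi_ne_zero,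
    neg_smul, one_smul, sub_eq_iff_eq_add] at e2
  rw [e1, e2]
  abel

end HasAxisDecay

end AxisTransform

/-! ### Restrictions to invariant subspaces. -/

section Restriction

variable {X : Type*} [NormedAddCommGroup X] [NormedSpace ℂ X] {T : X →ₗ.[ℂ] X}

theorem solves_restrictTo_iff {U : Submodule ℂ X} {hU : T.IsInvariant U} {z : ℂ} {u y : U} :
    (T.restrictTo U hU).Solves z u y ↔ T.Solves z (u : X) (y : X) :=
  ⟨fun ⟨hu, e⟩ => ⟨hu, congrArg Subtype.val e⟩, fun ⟨hu, e⟩ => ⟨hu, Subtype.ext e⟩⟩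

/-- A bounded operator which leaves `U` invariant and inverts `T - z` there induces the resolvent
of the restriction of `T` to `U`. -/
theorem restrictTo_mem_and_norm_le {U : Submodule ℂ X} (hU : T.IsInvariant U) {z : ℂ}
    {A : X →L[ℂ] X} (hAU : ∀ x ∈ U, A x ∈ U) (hA : ∀ x ∈ U, T.Solves z (A x) x)
    (hA' : ∀ u ∈ U, ∀ y, T.Solves z u y → A y = u) :
    z ∈ (T.restrictTo U hU).opResolventSet ∧
      ‖(T.restrictTo U hU).opResolvent z‖ ≤ ‖A‖ := by
  set R : U →L[ℂ] U := (A ∘L U.subtypeL).codRestrict U fun x => hAU x x.2 with hR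
  have h : (T.restrictTo U hU).IsResolventAt z R := by
    refine IsResolventAt.of_solves (fun x => ?_) fun u y hu => ?_
    · rw [solves_restrictTo_iff]
      exact hA x x.2
    · exact Subtype.ext (hA' u u.2 y (solves_restrictTo_iff.1 hu))
  refine ⟨⟨R, h⟩, ?_⟩
  rw [h.opResolvent_eq]
  exact ContinuousLinearMap.opNorm_le_bound _ (norm_nonneg _) fun x => A.le_opNorm x

theorem solves_opResolvent_restrictTo {U : Submodule ℂ X} {hU : T.IsInvariant U} {z : ℂ}
    (hz : z ∈ (T.restrictTo U hU).opResolventSet) (x : U) :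
    T.Solves z ((T.restrictTo U hU).opResolvent z x : X) x :=
  solves_restrictTo_iff.1 ((isResolventAt_opResolvent hz).solves x)

theorem IsDichotomousWrt.mem_pos {Xp Xm : Submodule ℂ X} (h : T.IsDichotomousWrt Xp Xm) {z : ℂ}
    (hz : z.re ≤ 0) : z ∈ (T.restrictTo Xp h.inv_pos).opResolventSet := by
  by_contra hn
  exact hz.not_gt (h.spec_pos hn)

theorem IsDichotomousWrt.mem_neg {Xp Xm : Submodule ℂ X} (h : T.IsDichotomousWrt Xp Xm) {z : ℂ}
    (hz : 0 ≤ z.re) : z ∈ (T.restrictTo Xm h.inv_neg).opResolventSet := by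
  by_contra hn
  exact hz.not_gt (h.spec_neg hn)

/-- Solve in each subspace and add; injectivity of `T - z` on the axis identifies the sum with `u`.
So the domain splits along the decomposition, which the definition does not demand. -/
theorem IsDichotomousWrt.exists_solves_add {Xp Xm : Submodule ℂ X}
    (h : T.IsDichotomousWrt Xp Xm) {z : ℂ} (hz : z.re = 0) {u y : X} (hu : T.Solves z u y) :
    ∃ up ∈ Xp, ∃ um ∈ Xm, ∃ yp ym, T.Solves z up yp ∧ T.Solves z um ym ∧ u = up + um ∧
      y = yp + ym := by
  obtain ⟨yp, hyp, ym, hym, rfl⟩ := Submodule.mem_sup.1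
    (h.isCompl.sup_eq_top ▸ Submodule.mem_top : y ∈ Xp ⊔ Xm)
  have hp := solves_opResolvent_restrictTo (h.mem_pos hz.le) ⟨yp, hyp⟩
  have hm := solves_opResolvent_restrictTo (h.mem_neg hz.ge) ⟨ym, hym⟩
  have hR := isResolventAt_opResolvent (h.imAxis_subset hz)
  exact ⟨_, Subtype.prop _, _, Subtype.prop _, yp, ym, hp, hm,
    (hu.eq_of_isResolventAt hR).trans ((hp.add hm).eq_of_isResolventAt hR).symm, rfl⟩

theorem exists_norm_restrictTo_apply_le {U : Submodule ℂ X} {hU : T.IsInvariant U} {s : Set ℂ}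
    {C : ℝ} (hC : ∀ z ∈ s, ‖(T.restrictTo U hU).opResolvent z‖ ≤ C) (x : U) :
    ∀ z ∈ s, ‖((T.restrictTo U hU).opResolvent z x : X)‖ ≤ C * ‖x‖ := fun z hz =>
  (ContinuousLinearMap.le_opNorm ((T.restrictTo U hU).opResolvent z) x).trans
    (mul_le_mul_of_nonneg_right (hC z hz) (norm_nonneg _))

theorem differentiableAt_restrictTo_apply {U : Submodule ℂ X} [CompleteSpace U]
    {hU : T.IsInvariant U} {z : ℂ} (hz : z ∈ (T.restrictTo U hU).opResolventSet) (x : U) :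
    DifferentiableAt ℂ (fun z => ((T.restrictTo U hU).opResolvent z x : X)) z :=
  U.subtypeL.differentiableAt.comp z
    ((differentiableAt_opResolvent hz).clm_apply (differentiableAt_const x))

end Restriction

/-! ### Strict dichotomy and boundedness of the spectral projection. -/

section SpectralProjection

variable {X : Type*} [NormedAddCommGroup X] [NormedSpace ℂ X]
  {T : X →ₗ.[ℂ] X} {β K : ℝ}

namespace HasAxisDecay

theorem exists_norm_axisTransform_apply_le_of_re_le (hT : T.HasAxisDecay β K) (x : X) {h : ℝ}
    (hh : 0 < h) : ∃ C, ∀ z : ℂ, z.re ≤ -h → ‖T.axisTransform z x‖ ≤ C := by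
  obtain ⟨C, hC⟩ := hT.exists_norm_axisTransform_apply_le x hh
  exact ⟨C, fun z hz => hC z (le_abs.2 (Or.inr (by linarith)))⟩

theorem exists_norm_axisTransform_apply_le_of_le_re (hT : T.HasAxisDecay β K) (x : X) {h : ℝ}
    (hh : 0 < h) : ∃ C, ∀ z : ℂ, h ≤ z.re → ‖T.axisTransform z x‖ ≤ C := by
  obtain ⟨C, hC⟩ := hT.exists_norm_axisTransform_apply_le x hh
  exact ⟨C, fun z hz => hC z (le_abs.2 (Or.inl hz))⟩

theorem opResolvent_zero_of_solves (hT : T.HasAxisDecay β K) {u y : X}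
    (h : T.Solves (-1 : ℝ) u y) : T.opResolvent 0 y = u + T.opResolvent 0 u := by
  have := (h.shift (w := 0)).eq_of_isResolventAt hT.isResolventAt_zero
  rw [ContinuousLinearMap.map_add, ContinuousLinearMap.map_smul] at this
  conv_rhs => enter [1]; rw [this]
  simp

/-- Solutions on a dense set of right-hand sides which are given by bounded operators yield
solutions for all right-hand sides. -/
theorem solves_of_dense (hT : T.HasAxisDecay β K) {D : Set X} (hD : Dense D) {A A' : X →L[ℂ] X}
    {z : ℂ} (h : ∀ u ∈ D, T.Solves z (A u) (A' u)) (x : X) : T.Solves z (A x) (A' x) := by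
  -- Being a solution is rewritten as an identity between bounded operators, which passes from a
  -- dense set to all of `X`.
  have key : ∀ x, A x = T.opResolvent 0 (A' x + (z - 0) • A x) := by
    refine congrFun (Continuous.ext_on hD (by fun_prop) (by fun_prop) fun u hu => ?_)
    exact ((h u hu).shift (w := 0)).eq_of_isResolventAt hT.isResolventAt_zero
  have h1 := (hT.isResolventAt_zero.solves (A' x + (z - 0) • A x)).shift (w := z)
  rw [← key] at h1
  simpa using h1

variable [CompleteSpace X]

/-- `A(z)` commutes with `T`, so `T - z` applied to `A(z) u` is `A(z)(T - z)u`, the projection of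
`u`. -/
theorem solves_axisTransform_of_re_neg (hT : T.HasAxisDecay β K) {z : ℂ} (hz : z.re < 0)
    {u y : X} (h : T.Solves (-1 : ℝ) u y) :
    T.Solves z (T.axisTransform z u) (T.axisTransform (-1 : ℝ) y) := by
  have h1 := h.shift (w := z)
  rw [← hT.axisTransform_of_re_neg hz h1 h]
  exact hT.solves_axisTransform hz.ne h1

theorem solves_axisTransform_of_re_pos (hT : T.HasAxisDecay β K) {z : ℂ} (hz : 0 < z.re)
    {u y : X} (h : T.Solves (-1 : ℝ) u y) :
    T.Solves z (T.axisTransform z u) (T.axisTransform (-1 : ℝ) y - u) := by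
  have h1 := h.shift (w := z)
  rw [← hT.axisTransform_of_re_pos hz h1 h]
  exact hT.solves_axisTransform hz.ne' h1

/-- A vector on which the resolvent has a bounded holomorphic continuation to the left half-plane
is fixed by the spectral projection. -/
theorem axisTransform_eq_self (hT : T.HasAxisDecay β K) {u y : X} (h : T.Solves (-1 : ℝ) u y)
    {F : ℂ → X} (hF : ∀ z : ℂ, z.re < 0 → T.Solves z (F z) u ∧ DifferentiableAt ℂ F z)
    {C : ℝ} (hC : ∀ z : ℂ, z.re ≤ 0 → ‖F z‖ ≤ C) : T.axisTransform (-1 : ℝ) y = u := by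
  refine (sub_eq_zero.1 (hT.eq_zero_of_solves (y := u - T.axisTransform (-1 : ℝ) y)
    (F := fun z => F z - T.axisTransform z u) (G := fun z => -T.axisTransform z u)
    (fun z hz => ⟨?_, ?_⟩) (fun h hh => ?_) (fun z hz => ⟨?_, ?_⟩) (fun h hh => ?_))).symm
  · exact (hF z hz).1.sub (hT.solves_axisTransform_of_re_neg hz h)
  · exact (hF z hz).2.fun_sub (hT.differentiableAt_axisTransform_apply u hz.ne)
  · obtain ⟨C', hC'⟩ := hT.exists_norm_axisTransform_apply_le_of_re_le u hh
    exact ⟨C + C', fun z hz => (norm_sub_le _ _).trans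
      (add_le_add (hC z (by linarith)) (hC' z hz))⟩
  · rw [← neg_sub _ u]
    exact (hT.solves_axisTransform_of_re_pos hz h).neg
  · exact (hT.differentiableAt_axisTransform_apply u hz.ne').fun_neg
  · simpa using hT.exists_norm_axisTransform_apply_le_of_le_re u hh

/-- A vector on which the resolvent has a bounded holomorphic continuation to the right half-plane
is annihilated by the spectral projection. -/
theorem axisTransform_eq_zero (hT : T.HasAxisDecay β K) {u y : X} (h : T.Solves (-1 : ℝ) u y)
    {G : ℂ → X} (hG : ∀ z : ℂ, 0 < z.re → T.Solves z (G z) u ∧ DifferentiableAt ℂ G z)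
    {C : ℝ} (hC : ∀ z : ℂ, 0 ≤ z.re → ‖G z‖ ≤ C) : T.axisTransform (-1 : ℝ) y = 0 := by
  refine hT.eq_zero_of_solves
    (F := fun z => T.axisTransform z u) (G := fun z => T.axisTransform z u + G z)
    (fun z hz => ⟨?_, ?_⟩) (fun h hh => ?_) (fun z hz => ⟨?_, ?_⟩) (fun h hh => ?_)
  · exact hT.solves_axisTransform_of_re_neg hz h
  · exact hT.differentiableAt_axisTransform_apply u hz.ne
  · exact hT.exists_norm_axisTransform_apply_le_of_re_le u hh
  · simpa using (hT.solves_axisTransform_of_re_pos hz h).add (hG z hz).1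
  · exact (hT.differentiableAt_axisTransform_apply u hz.ne').fun_add (hG z hz).2
  · obtain ⟨C', hC'⟩ := hT.exists_norm_axisTransform_apply_le_of_le_re u hh
    exact ⟨C' + C, fun z hz => (norm_add_le _ _).trans
      (add_le_add (hC' z hz) (hC z (by linarith)))⟩

end HasAxisDecay

variable [CompleteSpace X]

/-- The Cauchy transform of the resolvent of a strictly dichotomous operator gives the projection
belonging to the decomposition. -/
theorem IsStrictlyDichotomousWrt.exists_projection {Xp Xm : Submodule ℂ X}
    (hX : T.IsStrictlyDichotomousWrt Xp Xm) (hT : T.HasAxisDecay β K) :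
    ∃ Q : X →L[ℂ] X, ∀ u y, T.Solves (-1 : ℝ) u y → T.axisTransform (-1 : ℝ) y = Q u := by
  have hd := hX.toIsDichotomousWrt
  have := hX.isClosed_pos.completeSpace_coe
  have := hX.isClosed_neg.completeSpace_coe
  obtain ⟨Cp, hCp⟩ := hX.bdd_pos
  obtain ⟨Cm, hCm⟩ := hX.bdd_neg
  have hpos : ∀ u ∈ Xp, ∀ y, T.Solves (-1 : ℝ) u y → T.axisTransform (-1 : ℝ) y = u :=
    fun u hu y h => hT.axisTransform_eq_self h
      (F := fun z => ((T.restrictTo Xp hd.inv_pos).opResolvent z ⟨u, hu⟩ : X))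
      (fun z hz => ⟨solves_opResolvent_restrictTo (hd.mem_pos hz.le) ⟨u, hu⟩,
        differentiableAt_restrictTo_apply (hd.mem_pos hz.le) _⟩)
      (exists_norm_restrictTo_apply_le (s := {z | z.re ≤ 0}) hCp _)
  have hneg : ∀ u ∈ Xm, ∀ y, T.Solves (-1 : ℝ) u y → T.axisTransform (-1 : ℝ) y = 0 :=
    fun u hu y h => hT.axisTransform_eq_zero h
      (G := fun z => ((T.restrictTo Xm hd.inv_neg).opResolvent z ⟨u, hu⟩ : X))
      (fun z hz => ⟨solves_opResolvent_restrictTo (hd.mem_neg hz.le) ⟨u, hu⟩,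
        differentiableAt_restrictTo_apply (hd.mem_neg hz.le) _⟩)
      (exists_norm_restrictTo_apply_le (s := {z | 0 ≤ z.re}) hCm _)
  have htop := Submodule.IsCompl.isTopCompl_of_isClosed hX.isCompl hX.isClosed_pos hX.isClosed_neg
  refine ⟨Xp.projectionL Xm htop, fun u y h => ?_⟩
  obtain ⟨up, hup, um, hum, yp, ym, hsp, hsm, rfl, hy⟩ :=
    hd.exists_solves_add Complex.zero_re (h.shift (w := 0))
  have h1 := hpos up hup _ (hsp.shift (w := (-1 : ℝ)))
  have h2 := hneg um hum _ (hsm.shift (w := (-1 : ℝ)))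
  have hy' : y = (yp + (0 - ((-1 : ℝ) : ℂ)) • up) + (ym + (0 - ((-1 : ℝ) : ℂ)) • um) := by
    rw [add_add_add_comm, ← hy, ← smul_add, add_assoc, ← add_smul]
    simp
  rw [hy', ContinuousLinearMap.map_add, h1, h2, ContinuousLinearMap.map_add]
  have e1 : Xp.projectionL Xm htop up = up := by
    have := Submodule.projection_apply_left hX.isCompl ⟨up, hup⟩
    simpa using this
  have e2 : Xp.projectionL Xm htop um = 0 := by
    have := Submodule.projection_apply_right hX.isCompl ⟨um, hum⟩
    simpa using this
  rw [e1, e2]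

namespace HasAxisDecay

variable {B : X →L[ℂ] X}

/-- If the spectral projection is given by a bounded operator on a dense subspace, it is given by
this operator on the whole domain. -/
theorem axisTransform_eq_of_dense (hT : T.HasAxisDecay β K) {D : Set X} (hD : Dense D)
    (hB : ∀ u ∈ D, ∃ y, T.Solves (-1 : ℝ) u y ∧ T.axisTransform (-1 : ℝ) y = B u) {u y : X}
    (h : T.Solves (-1 : ℝ) u y) : T.axisTransform (-1 : ℝ) y = B u := by
  have hcomm : ∀ x, T.opResolvent 0 (T.axisTransform (-1 : ℝ) x) =
      T.axisTransform (-1 : ℝ) (T.opResolvent 0 x) :=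
    DFunLike.congr_fun (hT.commute_axisTransform (Commute.refl _) (by simp)).eq
  -- The projection composed with `T.opResolvent 0` is a bounded operator even if the projection is
  -- not. The identity therefore extends from `D` by continuity, and injectivity of `T.opResolvent
  -- 0` removes the factor.
  have key : ∀ x, T.opResolvent 0 (B x) = T.axisTransform (-1 : ℝ) (x + T.opResolvent 0 x) := by
    refine congrFun (Continuous.ext_on hD (by fun_prop) (by fun_prop) fun u hu => ?_)
    obtain ⟨y, hy, e⟩ := hB u hu
    rw [← e, hcomm, hT.opResolvent_zero_of_solves hy]
  refine sub_eq_zero.1 (hT.isResolventAt_zero.injective ?_)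
  rw [ContinuousLinearMap.map_sub, key, hcomm, hT.opResolvent_zero_of_solves h, sub_self]

theorem commute_of_axisTransform_eq (hT : T.HasAxisDecay β K) (hD : Dense (T.domain : Set X))
    (hB : ∀ u y, T.Solves (-1 : ℝ) u y → T.axisTransform (-1 : ℝ) y = B u) :
    Commute B (T.opResolvent 0) := by
  have hc : ∀ x, B (T.opResolvent 0 x) = T.opResolvent 0 (B x) := by
    refine congrFun (Continuous.ext_on hD (by fun_prop) (by fun_prop) fun u hu => ?_)
    have h : T.Solves (-1 : ℝ) u (T ⟨u, hu⟩ - ((-1 : ℝ) : ℂ) • u) := ⟨hu, by simp⟩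
    change B (T.opResolvent 0 u) = T.opResolvent 0 (B u)
    rw [← hB _ _ h, ← hB _ _ (h.map_of_commute hT.isResolventAt_zero (Commute.refl _))]
    exact (DFunLike.congr_fun (hT.commute_axisTransform (Commute.refl _) (by simp)).eq _).symm
  exact ContinuousLinearMap.ext hc

theorem solves_axisTransform_eq_of_re_neg (hT : T.HasAxisDecay β K)
    (hD : Dense (T.domain : Set X))
    (hB : ∀ u y, T.Solves (-1 : ℝ) u y → T.axisTransform (-1 : ℝ) y = B u) {z : ℂ}
    (hz : z.re < 0) (x : X) : T.Solves z (T.axisTransform z x) (B x) := by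
  refine hT.solves_of_dense hD (fun u hu => ?_) x
  have h : T.Solves (-1 : ℝ) u (T ⟨u, hu⟩ - ((-1 : ℝ) : ℂ) • u) := ⟨hu, by simp⟩
  rw [← hB _ _ h]
  exact hT.solves_axisTransform_of_re_neg hz h

theorem solves_axisTransform_eq_of_re_pos (hT : T.HasAxisDecay β K)
    (hD : Dense (T.domain : Set X))
    (hB : ∀ u y, T.Solves (-1 : ℝ) u y → T.axisTransform (-1 : ℝ) y = B u) {z : ℂ}
    (hz : 0 < z.re) (x : X) : T.Solves z (T.axisTransform z x) (B x - x) := by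
  refine hT.solves_of_dense (A' := B - ContinuousLinearMap.id ℂ X) hD (fun u hu => ?_) x
  have h : T.Solves (-1 : ℝ) u (T ⟨u, hu⟩ - ((-1 : ℝ) : ℂ) • u) := ⟨hu, by simp⟩
  change T.Solves z _ (B u - u)
  rw [← hB _ _ h]
  exact hT.solves_axisTransform_of_re_pos hz h

/-- `A(z)(x - B x)` on the left and `-A(z) B x` on the right both solve `(T - z) v = B x - B (B x)`,
so the Liouville argument applies; no double integral is needed. -/
theorem projection_idem (hT : T.HasAxisDecay β K) (hD : Dense (T.domain : Set X))
    (hB : ∀ u y, T.Solves (-1 : ℝ) u y → T.axisTransform (-1 : ℝ) y = B u) (x : X) :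
    B (B x) = B x := by
  refine (sub_eq_zero.1 (hT.eq_zero_of_solves (y := B x - B (B x))
    (F := fun z => T.axisTransform z (x - B x)) (G := fun z => -T.axisTransform z (B x))
    (fun z hz => ⟨?_, ?_⟩) (fun h hh => ?_) (fun z hz => ⟨?_, ?_⟩) (fun h hh => ?_))).symm
  · rw [← B.map_sub]
    exact hT.solves_axisTransform_eq_of_re_neg hD hB hz _
  · exact hT.differentiableAt_axisTransform_apply _ hz.ne
  · exact hT.exists_norm_axisTransform_apply_le_of_re_le _ hh
  · rw [← neg_sub _ (B x)]
    exact (hT.solves_axisTransform_eq_of_re_pos hD hB hz _).neg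
  · exact (hT.differentiableAt_axisTransform_apply _ hz.ne').fun_neg
  · simpa using hT.exists_norm_axisTransform_apply_le_of_le_re (B x) hh

/-- If the spectral projection is bounded, then the operator is strictly dichotomous. -/
theorem isStrictlyDichotomousWrt (hT : T.HasAxisDecay β K) (hD : Dense (T.domain : Set X))
    (hB : ∀ u y, T.Solves (-1 : ℝ) u y → T.axisTransform (-1 : ℝ) y = B u) :
    T.IsStrictlyDichotomousWrt (B - ContinuousLinearMap.id ℂ X).ker B.ker := by
  have hidem := hT.projection_idem hD hB
  have hcomm := hT.commute_of_axisTransform_eq hD hB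
  have memp : ∀ {x : X}, x ∈ (B - ContinuousLinearMap.id ℂ X).ker ↔ B x = x := fun {x} => by
    rw [LinearMap.mem_ker]
    exact sub_eq_zero
  have memm : ∀ {x : X}, x ∈ B.ker ↔ B x = 0 := fun {x} => LinearMap.mem_ker
  have hTB : ∀ {z : ℂ} {u y : X}, T.Solves z u y → T.Solves z (B u) (B y) := fun h =>
    h.map_of_commute hT.isResolventAt_zero hcomm
  have hTB' : ∀ u : T.domain, ∃ h : B u ∈ T.domain, T ⟨B u, h⟩ = B (T u) := fun u => by
    obtain ⟨h, e⟩ := hTB (z := 0) (u := u) (y := T u) ⟨u.2, by simp⟩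
    exact ⟨h, by simpa using e⟩
  have invp : T.IsInvariant (B - ContinuousLinearMap.id ℂ X).ker := fun u hu => by
    obtain ⟨h, e⟩ := hTB' u
    rw [memp] at hu ⊢
    rw [← e]
    congr 1
    exact Subtype.ext hu
  have invm : T.IsInvariant B.ker := fun u hu => by
    obtain ⟨h, e⟩ := hTB' u
    rw [memm] at hu ⊢
    rw [← e, ← T.map_zero]
    congr 1
    exact Subtype.ext hu
  have hax : ∀ {z : ℂ}, z.re ≠ 0 → ∀ x, B (T.axisTransform z x) = T.axisTransform z (B x) :=
    fun hz => DFunLike.congr_fun (hT.commute_axisTransform hcomm hz).eq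
  have hres : ∀ {z : ℂ}, z ∈ T.opResolventSet → ∀ x,
      B (T.opResolvent z x) = T.opResolvent z (B x) := fun hz => DFunLike.congr_fun
    (hT.isResolventAt_zero.commute (isResolventAt_opResolvent hz) hcomm).eq
  obtain ⟨h, hh, C, hC⟩ := hT.exists_strip
  obtain ⟨C', hC'⟩ := hT.exists_norm_axisTransform_le hh
  -- Near the axis, where the bound on `A(z)` degenerates, use the resolvent of `T`. Beyond the
  -- strip use `A(z)`, which inverts `T - z` where `B x = x`; on `B.ker` its negative does.
  have resp : ∀ z : ℂ, z.re ≤ 0 → z ∈ (T.restrictTo _ invp).opResolventSet ∧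
      ‖(T.restrictTo _ invp).opResolvent z‖ ≤ max C C' := fun z hz => by
    rcases le_or_gt |z.re| h with h1 | h1
    · have hR := isResolventAt_opResolvent (hC z h1).1
      have := restrictTo_mem_and_norm_le invp (A := T.opResolvent z)
        (fun x hx => memp.2 (by rw [hres (hC z h1).1, memp.1 hx])) (fun x _ => hR.solves x)
        (fun u _ y hu => (hu.eq_of_isResolventAt hR).symm)
      exact ⟨this.1, this.2.trans (le_max_of_le_left (hC z h1).2)⟩
    · have hz' : z.re < 0 := lt_of_le_of_ne hz fun h0 => by simp [h0] at h1; linarith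
      have := restrictTo_mem_and_norm_le invp (A := T.axisTransform z)
        (fun x hx => memp.2 (by rw [hax hz'.ne, memp.1 hx]))
        (fun x hx => by
          simpa [memp.1 hx] using hT.solves_axisTransform_eq_of_re_neg hD hB hz' x)
        (fun u hu y hs => by
          rw [hT.axisTransform_of_re_neg hz' hs hs.shift, hB _ _ hs.shift, memp.1 hu])
      exact ⟨this.1, this.2.trans (le_max_of_le_right (hC' z h1.le))⟩
  have resm : ∀ z : ℂ, 0 ≤ z.re → z ∈ (T.restrictTo _ invm).opResolventSet ∧
      ‖(T.restrictTo _ invm).opResolvent z‖ ≤ max C C' := fun z hz => by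
    rcases le_or_gt |z.re| h with h1 | h1
    · have hR := isResolventAt_opResolvent (hC z h1).1
      have := restrictTo_mem_and_norm_le invm (A := T.opResolvent z)
        (fun x hx => memm.2 (by rw [hres (hC z h1).1, memm.1 hx, ContinuousLinearMap.map_zero]))
        (fun x _ => hR.solves x) (fun u _ y hu => (hu.eq_of_isResolventAt hR).symm)
      exact ⟨this.1, this.2.trans (le_max_of_le_left (hC z h1).2)⟩
    · have hz' : 0 < z.re := lt_of_le_of_ne' hz fun h0 => by simp [h0] at h1; linarith
      have := restrictTo_mem_and_norm_le invm (A := -T.axisTransform z)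
        (fun x hx => memm.2 (by
          change B (-T.axisTransform z x) = 0
          rw [B.map_neg, hax hz'.ne', memm.1 hx, ContinuousLinearMap.map_zero, neg_zero]))
        (fun x hx => by
          simpa [memm.1 hx] using (hT.solves_axisTransform_eq_of_re_pos hD hB hz' x).neg)
        (fun u hu y hs => by
          change -T.axisTransform z y = u
          rw [hT.axisTransform_of_re_pos hz' hs hs.shift, hB _ _ hs.shift, memm.1 hu]
          simp)
      rw [norm_neg] at this
      exact ⟨this.1, this.2.trans (le_max_of_le_right (hC' z h1.le))⟩
  exact
    { isClosed_pos := ContinuousLinearMap.isClosed_ker _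
      isClosed_neg := ContinuousLinearMap.isClosed_ker _
      isCompl := by
        rw [isCompl_iff, Submodule.disjoint_def, codisjoint_iff, Submodule.eq_top_iff']
        refine ⟨fun x hx hx' => (memp.1 hx).symm.trans (memm.1 hx'), fun x => ?_⟩
        rw [← add_sub_cancel (B x) x]
        refine Submodule.add_mem_sup (memp.2 (hidem x)) (memm.2 ?_)
        rw [B.map_sub, hidem, sub_self]
      imAxis_subset := fun z hz => (hC z (by
        rw [show z.re = 0 from hz, abs_zero]
        exact hh.le)).1
      inv_pos := invp
      inv_neg := invm
      spec_pos := fun z hz => not_le.1 fun h0 => hz (resp z h0).1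
      spec_neg := fun z hz => not_le.1 fun h0 => hz (resm z h0).1
      bdd_pos := ⟨_, fun z hz => (resp z hz).2⟩
      bdd_neg := ⟨_, fun z hz => (resm z hz).2⟩ }

end HasAxisDecay

end SpectralProjection

end LinearPMap

/-! ### From weighted bounds to decay estimates. -/

section Decay

variable {E : Type*} [NormedAddCommGroup E]

/-- The weight `|τ| ^ s` gives no control near 0, where continuity on `[-1, 1]` takes over;
elsewhere `1 + |τ| ≤ 2|τ|`, whence `2 ^ s`. -/
theorem exists_norm_le_one_add_abs_rpow {g : ℝ → E} (hg : Continuous g) {s C : ℝ} (hs : 0 ≤ s)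
    (hC : ∀ τ : ℝ, τ ≠ 0 → |τ| ^ s * ‖g τ‖ ≤ C) :
    ∃ K, ∀ τ, ‖g τ‖ ≤ K * (1 + |τ|) ^ (-s) := by
  obtain ⟨C', hC'⟩ := (isCompact_Icc (a := (-1 : ℝ)) (b := 1)).exists_bound_of_continuousOn
    hg.continuousOn
  refine ⟨(2 : ℝ) ^ s * max C C', fun τ => ?_⟩
  have hu : 0 < 1 + |τ| := by positivity
  rw [Real.rpow_neg hu.le, ← div_eq_mul_inv, le_div_iff₀ (Real.rpow_pos_of_pos hu s)]
  rcases le_total |τ| 1 with h | h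
  · calc ‖g τ‖ * (1 + |τ|) ^ s ≤ C' * (2 : ℝ) ^ s :=
          mul_le_mul (hC' τ (abs_le.1 h)) (Real.rpow_le_rpow hu.le (by linarith) hs)
            (Real.rpow_nonneg hu.le s) ((norm_nonneg _).trans (hC' τ (abs_le.1 h)))
      _ ≤ (2 : ℝ) ^ s * max C C' := by
          rw [mul_comm]
          gcongr
          exact le_max_right _ _
  · calc ‖g τ‖ * (1 + |τ|) ^ s ≤ ‖g τ‖ * (2 * |τ|) ^ s := by
          gcongr
          linarith
      _ = (2 : ℝ) ^ s * (|τ| ^ s * ‖g τ‖) := by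
          rw [Real.mul_rpow (by norm_num) (abs_nonneg _)]
          ring
      _ ≤ (2 : ℝ) ^ s * max C C' := by
          gcongr
          exact (hC τ (abs_pos.1 (by linarith))).trans (le_max_left _ _)

end Decay

namespace LinearPMap

/-! ### Perturbation of the resolvent and of the spectral projection. -/

section Perturbation

variable {X : Type*} [NormedAddCommGroup X] [NormedSpace ℂ X] {S T : X →ₗ.[ℂ] X} {β K : ℝ}

theorem HasAxisDecay.norm_opResolvent_le (hT : T.HasAxisDecay β K) {z : ℂ} (hz : z.re = 0)
    (hz0 : z ≠ 0) : ‖T.opResolvent z‖ ≤ K / ‖z‖ ^ β := by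
  have hzI : (z.im : ℂ) * I = z := by
    conv_rhs => rw [← Complex.re_add_im z, hz]
    simp
  have hn : ‖z‖ = |z.im| := by
    conv_lhs => rw [← hzI]
    simp
  have h := hT.norm_le z.im
  have hK := hT.const_nonneg
  rw [hzI] at h
  have hpos : 0 < |z.im| := hn ▸ norm_pos_iff.2 hz0
  rw [hn, div_eq_mul_inv, ← Real.rpow_neg hpos.le]
  refine h.trans (mul_le_mul_of_nonneg_left ?_ hK)
  exact Real.rpow_le_rpow_of_nonpos hpos (by linarith) (neg_nonpos.2 hT.exponent_pos.le)

/-- A difference decaying at least as fast as the resolvent of `S` preserves its rate. This serves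
both exponent `β` and, for bisectoriality, exponent 1. -/
theorem HasAxisDecay.perturb (hS : S.HasAxisDecay β K)
    (hT : {z : ℂ | z.re = 0} ⊆ T.opResolventSet) {s K' : ℝ} (hs : β ≤ s)
    (hST : ∀ τ : ℝ, ‖S.opResolvent ((τ : ℂ) * I) - T.opResolvent ((τ : ℂ) * I)‖ ≤
      K' * (1 + |τ|) ^ (-s)) : T.HasAxisDecay β (K + K') := by
  have hK' : 0 ≤ K' := by simpa using (norm_nonneg _).trans (hST 0)
  refine ⟨hS.exponent_pos, fun τ => hT (by simp), fun τ => ?_⟩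
  have h1 : (1 + |τ|) ^ (-s) ≤ (1 + |τ|) ^ (-β) :=
    Real.rpow_le_rpow_of_exponent_le (by simp) (neg_le_neg hs)
  calc ‖T.opResolvent ((τ : ℂ) * I)‖
      ≤ ‖S.opResolvent ((τ : ℂ) * I)‖ +
        ‖S.opResolvent ((τ : ℂ) * I) - T.opResolvent ((τ : ℂ) * I)‖ := by
        rw [norm_sub_rev]
        simpa using norm_add_le (S.opResolvent ((τ : ℂ) * I))
          (T.opResolvent ((τ : ℂ) * I) - S.opResolvent ((τ : ℂ) * I))
    _ ≤ K * (1 + |τ|) ^ (-β) + K' * (1 + |τ|) ^ (-β) :=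
        add_le_add (hS.norm_le τ) ((hST τ).trans (mul_le_mul_of_nonneg_left h1 hK'))
    _ = (K + K') * (1 + |τ|) ^ (-β) := by ring

variable [CompleteSpace X]

theorem exists_hasAxisDecay (hS : {z : ℂ | z.re = 0} ⊆ S.opResolventSet) {s M : ℝ} (hs : 0 < s)
    (hM : ∀ z : ℂ, z.re = 0 → z ≠ 0 → ‖S.opResolvent z‖ ≤ M / ‖z‖ ^ s) :
    ∃ K, S.HasAxisDecay s K := by
  obtain ⟨K, hK⟩ := exists_norm_le_one_add_abs_rpow (continuous_opResolvent_axis hS) hs.le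
    (C := M) fun τ hτ => by
      have h := hM ((τ : ℂ) * I) (by simp) (by simp [hτ])
      have hpos : 0 < |τ| ^ s := Real.rpow_pos_of_pos (abs_pos.2 hτ) s
      rwa [norm_mul, Complex.norm_real, Complex.norm_I, mul_one, Real.norm_eq_abs,
        le_div_iff₀ hpos, mul_comm] at h
  exact ⟨K, hs, fun τ => hS (by simp), hK⟩

theorem exists_norm_opResolvent_sub_le (hS : {z : ℂ | z.re = 0} ⊆ S.opResolventSet)
    (hT : {z : ℂ | z.re = 0} ⊆ T.opResolventSet) {s C : ℝ} (hs : 0 ≤ s)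
    (hST : ∀ z : ℂ, z.re = 0 → ‖z‖ ^ s * ‖S.opResolvent z - T.opResolvent z‖ ≤ C) :
    ∃ K, ∀ τ : ℝ, ‖S.opResolvent ((τ : ℂ) * I) - T.opResolvent ((τ : ℂ) * I)‖ ≤
      K * (1 + |τ|) ^ (-s) :=
  exists_norm_le_one_add_abs_rpow
    ((continuous_opResolvent_axis hS).sub (continuous_opResolvent_axis hT)) hs (C := C)
    fun τ _ => by simpa using hST ((τ : ℂ) * I) (by simp)

/-- On the intersection of the domains the spectral projections of two operators differ by the
integral of the difference of their resolvents. -/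
theorem HasAxisDecay.axisTransform_sub_axisTransform {K' : ℝ} (hS : S.HasAxisDecay β K)
    (hT : T.HasAxisDecay β K') (hint : Integrable fun τ : ℝ =>
      S.opResolvent ((τ : ℂ) * I) - T.opResolvent ((τ : ℂ) * I)) {u y y' : X}
    (h : S.Solves (-1 : ℝ) u y) (h' : T.Solves (-1 : ℝ) u y') :
    S.axisTransform (-1 : ℝ) y - T.axisTransform (-1 : ℝ) y' = ((2 * Real.pi : ℝ) : ℂ)⁻¹ •
      (∫ τ : ℝ, S.opResolvent ((τ : ℂ) * I) - T.opResolvent ((τ : ℂ) * I)) u := by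
  have hre : ((-1 : ℝ) : ℂ).re ≠ 0 := by simp
  rw [hS.axisTransform_apply hre, hT.axisTransform_apply hre, ← smul_sub, ← integral_sub
    (hS.integrable_kernel_smul_apply hre y) (hT.integrable_kernel_smul_apply hre y'),
    ContinuousLinearMap.integral_apply hint]
  congr 2
  ext τ
  -- Both integrands contain the same term `(iτ + 1)⁻¹ • u`, which cancels.
  rw [hS.kernel_smul_apply hre h, hT.kernel_smul_apply hre h']
  exact add_sub_add_right_eq_sub _ _ _

/-- Strict dichotomy is stable under perturbations with an integrable resolvent difference. -/
theorem IsStrictlyDichotomousWrt.perturb {Xp Xm : Submodule ℂ X} {K' : ℝ}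
    (hX : S.IsStrictlyDichotomousWrt Xp Xm) (hS : S.HasAxisDecay β K) (hT : T.HasAxisDecay β K')
    (hint : Integrable fun τ : ℝ => S.opResolvent ((τ : ℂ) * I) - T.opResolvent ((τ : ℂ) * I))
    (hD : Dense ((S.domain ⊓ T.domain : Submodule ℂ X) : Set X)) : T.IsStrictlyDichotomous := by
  obtain ⟨Q, hQ⟩ := hX.exists_projection hS
  refine ⟨_, _, hT.isStrictlyDichotomousWrt (hD.mono fun x hx => hx.2) fun u y h =>
    hT.axisTransform_eq_of_dense (B := Q - ((2 * Real.pi : ℝ) : ℂ)⁻¹ •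
      ∫ τ : ℝ, S.opResolvent ((τ : ℂ) * I) - T.opResolvent ((τ : ℂ) * I)) hD
      (fun u hu => ?_) h⟩
  have hu1 : S.Solves (-1 : ℝ) u (S ⟨u, hu.1⟩ - ((-1 : ℝ) : ℂ) • u) := ⟨hu.1, by simp⟩
  have hu2 : T.Solves (-1 : ℝ) u (T ⟨u, hu.2⟩ - ((-1 : ℝ) : ℂ) • u) := ⟨hu.2, by simp⟩
  refine ⟨_, hu2, ?_⟩
  change _ = Q u - ((2 * Real.pi : ℝ) : ℂ)⁻¹ •
    (∫ τ : ℝ, S.opResolvent ((τ : ℂ) * I) - T.opResolvent ((τ : ℂ) * I)) u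
  rw [← hQ _ _ hu1, ← hS.axisTransform_sub_axisTransform hT hint hu1 hu2, sub_sub_cancel]

end Perturbation

end LinearPMap

theorem theorem7p3 {X : Type*} [NormedAddCommGroup X] [NormedSpace ℂ X] [CompleteSpace X]
    (S T : X →ₗ.[ℂ] X) (β ε : ℝ)
    (hS_dense : Dense (S.domain : Set X))
    (hS_alm : S.IsAlmostBisectorialWith β)
    (hS_dich : S.IsStrictlyDichotomous)
    (hT_dense : Dense (T.domain : Set X))
    (hε : 0 < ε)
    (hT_res : {z : ℂ | z.re = 0} ⊆ T.opResolventSet)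
    (hST : ∃ C : ℝ, ∀ z : ℂ, z.re = 0 →
      ‖z‖ ^ (1 + ε) * ‖S.opResolvent z - T.opResolvent z‖ ≤ C)
    (hST_dense : Dense ((S.domain ⊓ T.domain : Submodule ℂ X) : Set X)) :
    T.IsStrictlyDichotomous ∧ T.IsAlmostBisectorialWith β ∧
      (S.IsBisectorial → T.IsBisectorial) := by
  obtain ⟨Xp, Xm, hX⟩ := hS_dich
  obtain ⟨⟨hβ, hβ1⟩, -, M, hM⟩ := hS_alm
  obtain ⟨C, hC⟩ := hST
  have hS_res := hX.imAxis_subset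
  have hT_res' : {z : ℂ | z.re = 0 ∧ z ≠ 0} ⊆ T.opResolventSet := fun z hz => hT_res hz.1
  obtain ⟨K, hS⟩ := LinearPMap.exists_hasAxisDecay hS_res hβ hM
  obtain ⟨K', hK'⟩ := LinearPMap.exists_norm_opResolvent_sub_le hS_res hT_res (by linarith) hC
  have hT := hS.perturb hT_res (by linarith) hK'
  -- Here the strict inequality `1 + ε > 1` is essential.
  have hint : Integrable fun τ : ℝ =>
      S.opResolvent ((τ : ℂ) * I) - T.opResolvent ((τ : ℂ) * I) :=
    ((integrable_one_add_abs_rpow hε).const_mul K').mono'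
      (hS.continuous_axis.sub hT.continuous_axis).aestronglyMeasurable (Eventually.of_forall hK')
  refine ⟨hX.perturb hS hT hint hST_dense, ⟨⟨hβ, hβ1⟩, hT_res', _,
    fun z hz hz0 => hT.norm_opResolvent_le hz hz0⟩, fun ⟨_, M', hM'⟩ => ⟨hT_res', ?_⟩⟩
  -- Bisectoriality, with `0` in the resolvent set, is axis decay with exponent 1.
  obtain ⟨K₁, hS₁⟩ := LinearPMap.exists_hasAxisDecay hS_res one_pos (M := M') (by simpa using hM')
  have hT₁ := hS₁.perturb hT_res (by linarith) hK'
  exact ⟨_, fun z hz hz0 => by simpa using hT₁.norm_opResolvent_le hz hz0⟩
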